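/- Let $\mathbb T$ be the unit circle, $m$ its normalized arclength measure, and $\sigma$ a Borel probability measure on $\mathbb T$ with infinite support. Let $\Phi_n$ be the monic orthogonal polynomials of $\sigma$, $\phi_n=\Phi_n/\|\Phi_n\|_{2,\sigma}$ the orthonormal ones, where $\|\cdot\|_{2,\sigma}$ is the norm of $L^2_\sigma(\mathbb T)$, and for $z\in\mathbb T$ put $\phi_n^*(z)=z^n\overline{\phi_n(z)}$ and $s_n(z)=z^{-n}\phi_{2n}(z)$. Let $\gamma_n=-\overline{\Phi_{n+1}(0)}$, $n\ge 0$, be the Verblunsky coefficients of $\sigma$, and assume $\bigl(\sum_{n\ge 0}|\gamma_n|^2\bigr)^{1/2}\le \tfrac12$. Let $h:\mathbb R\to[0,\infty)$ be a $C^\infty$ function, independent of $\kappa$, with compact support in $[-2\pi,2\pi]$. For $\kappa\in\mathbb N$ and $0\le j\le\kappa-1$ put $z_j=e^{2\pi i j/\kappa}$ and $\omega_j(z)=\omega_0(z/z_j)$, where $\omega_0(e^{ix})=h(\kappa x)$ for $-\pi<x\le\pi$, and assume that for all sufficiently large $\kappa$ these functions form a partition of unity: $\sum_{j=0}^{\kappa-1}\omega_j=1$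 on $\mathbb T$. Let $\alpha_{j,u}=\int_{\mathbb T}\omega_j(z)z^{-u}\,dm(z)$, $u\in\mathbb Z$, be the Fourier coefficients of $\omega_j$. Let $f_{j,\kappa}$, $0\le j\le \kappa-1$, be complex numbers with $|f_{j,\kappa}|\le C$ for some constant $C$ independent of $j$ and $\kappa$. Set $$A_\kappa=\sum_{j=0}^{\kappa-1}\ \sum_{|u|\le\kappa^2} f_{j,\kappa}\,s_{\kappa^2+2j\kappa+u}\,\alpha_{j,u},\qquad B_\kappa=\sum_{j=0}^{\kappa-1} f_{j,\kappa}\,s_{\kappa^2+2j\kappa}\,\omega_j .$$ Then, for all sufficiently large $\kappa$, $\omega_j(z)=\sum_{u\in\mathbb Z}\alpha_{j,u}z^u$ for all $0\le j\le\kappa-1$ and $z\in\mathbb T$, with an absolutely convergent series; moreover $$\|A_\kappa-B_\kappa\|_{2,\sigma}\to 0\qquad(\kappa\to\infty)$$ and $$\sum_{j=0}^{\kappa-1}|f_{j,\kappa}|^2\,\bigl\|\phi^*_{2(\kappa^2+2j\kappa)}\,\omega_j\bigr\|_{2,\sigma}^2-\int_{\mathbb T}\sum_{j=0}^{\kappa-1}|f_{j,\kappa}|^2|\omega_j|^2\,dm=o(1)\qquad(\kappa\to\infty).$$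 -/

import Mathlib

open MeasureTheory Filter Topology Polynomial
open scoped ENNReal ContDiff

noncomputable section

namespace OPUC

/-- The unit circle carries its Borel σ-algebra. -/
instance circleMeasurableSpace : MeasurableSpace Circle := borel Circle

instance circleBorelSpace : BorelSpace Circle := ⟨rfl⟩

/-- The normalized arclength measure `m` on the unit circle: the image of `dx / (2π)` on
`(-π, π]` under `x ↦ e^{ix}`. -/
def arcMeasure : Measure Circle :=
  ENNReal.ofReal (1 / (2 * Real.pi)) •
    (volume.restrict (Set.Ioc (-Real.pi) Real.pi)).map Circle.exp

/-- The norm of `L²_σ` on the unit circle, as a real number. -/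
def l2Norm (σ : Measure Circle) (g : Circle → ℂ) : ℝ :=
  (eLpNorm g 2 σ).toReal

/-- The inner product `⟨p, q⟩_σ = ∫ p(z) conj(q(z)) dσ(z)` of two polynomials in `L²_σ`,
linear in the first argument. -/
def polyInner (σ : Measure Circle) (p q : ℂ[X]) : ℂ :=
  ∫ z : Circle, p.eval (z : ℂ) * (starRingEnd ℂ) (q.eval (z : ℂ)) ∂σ

/-- The monic orthogonal polynomials `Φ_n` of `σ`: the Gram-Schmidt orthogonalization in `L²_σ`
of `1, z, z², …`. -/
def monicOP (σ : Measure Circle) : ℕ → ℂ[X]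
  | n => X ^ n - ∑ k : Fin n,
      C (polyInner σ (X ^ n) (monicOP σ k) / polyInner σ (monicOP σ k) (monicOP σ k)) *
        monicOP σ k
  termination_by n => n
  decreasing_by all_goals exact k.isLt

/-- The orthonormal polynomials `φ_n = Φ_n / ‖Φ_n‖_{2,σ}`, as functions on the circle. -/
def phi (σ : Measure Circle) (n : ℕ) (z : Circle) : ℂ :=
  (monicOP σ n).eval (z : ℂ) /
    ((l2Norm σ fun w : Circle => (monicOP σ n).eval (w : ℂ) : ℝ) : ℂ)

/-- The reversed polynomials `φ_n^*(z) = z ^ n * conj (φ_n(z))` on the circle. -/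
def phiStar (σ : Measure Circle) (n : ℕ) (z : Circle) : ℂ :=
  (z : ℂ) ^ n * (starRingEnd ℂ) (phi σ n z)

/-- The functions `s_n(z) = z ^ (-n) * φ_{2n}(z)` on the circle. -/
def s (σ : Measure Circle) (n : ℕ) (z : Circle) : ℂ :=
  (z : ℂ) ^ (-(n : ℤ)) * phi σ (2 * n) z

/-- The Verblunsky coefficients of `σ`. They are the `γ_n` in the Szegő recurrence
`Φ_{n+1}(z) = z Φ_n(z) - conj γ_n * Φ_n^*(z)`; since `Φ_n^*(0) = 1`, evaluation at `z = 0` gives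
`γ_n = - conj (Φ_{n+1}(0))`. -/
def verblunsky (σ : Measure Circle) (n : ℕ) : ℂ :=
  -(starRingEnd ℂ) ((monicOP σ (n + 1)).eval 0)

/-- The `κ`-th roots of unity `z_j = exp(2πij/κ)`. -/
def root (κ j : ℕ) : Circle := Circle.exp (2 * Real.pi * j / κ)

/-- The bumps `ω_j(z) = ω_0(z / z_j)`, where `ω_0(e^{ix}) = h(κ x)` for `-π < x ≤ π`. -/
def bump (h : ℝ → ℝ) (κ j : ℕ) (z : Circle) : ℝ :=
  h (κ * Complex.arg ((z / root κ j : Circle) : ℂ))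

/-- The Fourier coefficients `α_{j,u} = ∫ ω_j(z) z ^ (-u) dm(z)` of `ω_j`. -/
def bumpCoeff (h : ℝ → ℝ) (κ j : ℕ) (u : ℤ) : ℂ :=
  ∫ z : Circle, (bump h κ j z : ℂ) * (z : ℂ) ^ (-u) ∂arcMeasure

/-- The wave-packet sum
`A = ∑_{j < κ} ∑_{|u| ≤ κ²} f_{j,κ} s_{κ² + 2jκ + u} α_{j,u}`. The index `κ² + 2jκ + u` is never
negative, so `Int.toNat` only changes its type. -/
def packetSum (σ : Measure Circle) (h : ℝ → ℝ) (f : ℕ → ℕ → ℂ) (κ : ℕ) (z : Circle) : ℂ :=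
  ∑ j ∈ Finset.range κ, ∑ u ∈ Finset.Icc (-(κ : ℤ) ^ 2) ((κ : ℤ) ^ 2),
    f κ j * s σ ((κ : ℤ) ^ 2 + 2 * j * κ + u).toNat z * bumpCoeff h κ j u

/-- The sum `B = ∑_{j < κ} f_{j,κ} s_{κ² + 2jκ} ω_j`. -/
def localizedSum (σ : Measure Circle) (h : ℝ → ℝ) (f : ℕ → ℕ → ℂ) (κ : ℕ) (z : Circle) : ℂ :=
  ∑ j ∈ Finset.range κ, f κ j * s σ (κ ^ 2 + 2 * j * κ) z * (bump h κ j z : ℂ)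

end OPUC

end

/-!
The proof rests on two properties of the functions `s_n = z^{-n} φ_{2n}`.

*Advancing the index is almost multiplication by a power of `z`.* The Szegő recurrence gives
`‖Φ_{n+1}‖² ≥ (1 - |γ_n|²) ‖Φ_n‖²` (`opNorm_succ_sq`). Since `⟨φ_{n+k}, z^k φ_n⟩` is the ratio
`‖Φ_{n+k}‖ / ‖Φ_n‖`, the squared norm of `φ_{n+k} - z^k φ_n` is at most twice the sum of `|γ_i|²`
over `n ≤ i < n + k` (`norm_phiMap_sub_sq_le`). For the defect `s_{n+u} - z^u s_n` the relevant
window of indices has radius `2|u|` around `2n` (`norm_defect_sq_le`).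

*Defects at distant indices are orthogonal.* The defect has frequencies in `[-(n + |u|), n + |u|]`
and is orthogonal to those in `[-(n - |u|), n - |u| - 1]`. So the defects at `(n, u)` and `(m, v)`
are orthogonal as soon as `|u| + |v| < |m - n|` (`inner_defect_eq_zero`).

The coefficients `α_{j,u}` are values of the Fourier transform of `h` on the scale `κ`, hence
bounded by a multiple of `κ⁻¹ (1 + |u| / κ)⁻⁵` (`exists_norm_bumpCoeff_le`), and Poisson summation
yields the Fourier expansion of the bumps (`hasSum_bumpCoeff`). As `s_n ω_j` is the sum of the
`α_{j,u} z^u s_n`, the difference of the two sums is a combination of defects, up to the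
frequencies `|u| > κ²`, which contribute `O(1 / κ)`. A Schur test restricted to non-orthogonal pairs
(`norm_sum_smul_sq_le`) bounds the squared norm of this combination by a constant times the sum of
`κ⁻¹ (1 + |u| / κ)⁻⁴ ‖defect‖²` over all `j` and `u`. The centers `κ² + 2jκ` are `2κ` apart, so for
each `u` the windows overlap at most `1 + |u| / κ` times up to a constant, and they lie beyond `κ²`
unless `|u|` is so large that the weight compensates (`sum_gammaWindow_le`). The total is a
multiple of a tail of `∑ |γ_i|²` plus `O(1 / κ)`.

For the norms of `φ^*_N ω_j`, expand `ω_j²` into its Fourier series. The `u`-th moment of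
`|φ_N|² dσ` equals, up to sign and conjugation, the inner product of `φ_{N+u} - z^u φ_N` and
`φ_N - z^u φ_{N-u}`, so it is quadratic in the Verblunsky coefficients
(`norm_inner_zpowMap_phiMap_le`). The overlap count then applies to the sum over `j`, and only the
moment `u = 0`, which gives the integral against `m`, survives.
-/

namespace OPUC

/-! ### Continuous functions on the circle in `L²_σ` -/

/-- The monomial `z ↦ z ^ u`, `u ∈ ℤ`, as a continuous function on the circle. -/
noncomputable def zpowMap (u : ℤ) : C(Circle, ℂ) where
  toFun z := ((z ^ u : Circle) : ℂ)
  continuous_toFun := continuous_subtype_val.comp (continuous_zpow u)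

theorem zpowMap_apply (u : ℤ) (z : Circle) : zpowMap u z = (z : ℂ) ^ u := by
  simp [zpowMap]

theorem zpowMap_add (u v : ℤ) : zpowMap (u + v) = zpowMap u * zpowMap v := by
  ext z
  simp [zpowMap_apply, zpow_add₀ z.coe_ne_zero]

@[simp] theorem zpowMap_zero : zpowMap 0 = 1 := by
  ext z
  simp [zpowMap_apply]

theorem norm_zpowMap_apply (u : ℤ) (z : Circle) : ‖zpowMap u z‖ = 1 :=
  Circle.norm_coe (z ^ u)

/-- Restriction of polynomials to the circle. -/
noncomputable def polyMap : ℂ[X] →ₐ[ℂ] C(Circle, ℂ) :=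
  aeval (zpowMap 1)

theorem polyMap_apply (p : ℂ[X]) (z : Circle) : polyMap p z = p.eval (z : ℂ) := by
  simp [polyMap, aeval_continuousMap_apply, zpowMap_apply]

theorem polyMap_X_pow (n : ℕ) : polyMap (X ^ n) = zpowMap n := by
  ext z
  simp [polyMap_apply, zpowMap_apply]

section L2

variable (σ : Measure Circle) [IsProbabilityMeasure σ]

/-- The class in `L²_σ` of a continuous function on the circle. -/
noncomputable abbrev toL2 : C(Circle, ℂ) →L[ℂ] Lp ℂ 2 σ :=
  ContinuousMap.toLp 2 σ ℂ

theorem inner_toL2 (f g : C(Circle, ℂ)) :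
    inner ℂ (toL2 σ f) (toL2 σ g) = ∫ z, g z * (starRingEnd ℂ) (f z) ∂σ :=
  ContinuousMap.inner_toLp σ f g

theorem polyInner_eq_inner (p q : ℂ[X]) :
    polyInner σ p q = inner ℂ (toL2 σ (polyMap q)) (toL2 σ (polyMap p)) := by
  simp [inner_toL2, polyInner, polyMap_apply]

/-- Multiplication by a power of `z` is isometric. -/
theorem inner_zpowMap_mul (k : ℤ) (f g : C(Circle, ℂ)) :
    inner ℂ (toL2 σ (zpowMap k * f)) (toL2 σ (zpowMap k * g)) =
      inner ℂ (toL2 σ f) (toL2 σ g) := by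
  rw [inner_toL2, inner_toL2]
  refine integral_congr_ae (Eventually.of_forall fun z => ?_)
  have h1 : zpowMap k z * (starRingEnd ℂ) (zpowMap k z) = 1 := by
    rw [Complex.mul_conj, Complex.normSq_eq_norm_sq, norm_zpowMap_apply]
    simp
  simp only [ContinuousMap.mul_apply, map_mul]
  linear_combination (g z * (starRingEnd ℂ) (f z)) * h1

theorem norm_zpowMap_mul (k : ℤ) (f : C(Circle, ℂ)) :
    ‖toL2 σ (zpowMap k * f)‖ = ‖toL2 σ f‖ := by
  rw [norm_eq_sqrt_re_inner (𝕜 := ℂ), inner_zpowMap_mul, ← norm_eq_sqrt_re_inner]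

theorem eLpNorm_eq_norm_toL2 (f : C(Circle, ℂ)) :
    eLpNorm f 2 σ = ENNReal.ofReal ‖toL2 σ f‖ := by
  rw [Lp.norm_def, ENNReal.ofReal_toReal (Lp.eLpNorm_ne_top _)]
  exact (eLpNorm_congr_ae (ContinuousMap.coeFn_toLp (p := 2) (𝕜 := ℂ) σ f)).symm

theorem l2Norm_eq_norm_toL2 (f : C(Circle, ℂ)) : l2Norm σ f = ‖toL2 σ f‖ := by
  rw [l2Norm, eLpNorm_eq_norm_toL2, ENNReal.toReal_ofReal (norm_nonneg _)]

theorem norm_toL2_sq (f : C(Circle, ℂ)) : ‖toL2 σ f‖ ^ 2 = ∫ z, ‖f z‖ ^ 2 ∂σ := by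
  have h := inner_self_eq_norm_sq_to_K (𝕜 := ℂ) (toL2 σ f)
  rw [inner_toL2] at h
  have h2 : ∀ z, f z * (starRingEnd ℂ) (f z) = ((‖f z‖ ^ 2 : ℝ) : ℂ) := fun z => by
    rw [Complex.mul_conj, Complex.normSq_eq_norm_sq]
  simp_rw [h2] at h
  rw [integral_complex_ofReal, ← RCLike.ofReal_pow] at h
  exact (Complex.ofReal_injective h).symm

/-- The product with a bounded function is bounded in `L²_σ`. -/
theorem norm_toL2_mul_le (f g : C(Circle, ℂ)) {c : ℝ} (hc : 0 ≤ c) (hg : ∀ z, ‖g z‖ ≤ c) :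
    ‖toL2 σ (f * g)‖ ≤ c * ‖toL2 σ f‖ := by
  refine (sq_le_sq₀ (norm_nonneg _) (by positivity)).1 ?_
  rw [mul_pow, norm_toL2_sq, norm_toL2_sq, ← integral_const_mul]
  refine integral_mono_of_nonneg (Eventually.of_forall fun z => by positivity)
    ?_ (Eventually.of_forall fun z => ?_)
  · exact ((map_continuous f).norm.pow 2).integrable_of_hasCompactSupport
      (HasCompactSupport.of_compactSpace _) |>.const_mul _
  · simp only [ContinuousMap.mul_apply, norm_mul, mul_pow]
    rw [mul_comm]
    gcongr
    exact hg z

end L2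

/-! ### Monic orthogonal polynomials -/

section Polynomials

theorem monicOP_monic (σ : Measure Circle) (n : ℕ) :
    (monicOP σ n).Monic ∧ (monicOP σ n).natDegree = n := by
  induction n using Nat.strong_induction_on with
  | _ n ih =>
    have hdeg : (∑ k : Fin n,
        C (polyInner σ (X ^ n) (monicOP σ k) / polyInner σ (monicOP σ k) (monicOP σ k)) *
          monicOP σ k).degree < n := by
      refine (degree_sum_le _ _).trans_lt ?_
      rw [Finset.sup_lt_iff (by exact_mod_cast WithBot.bot_lt_coe n)]
      intro k _
      refine (degree_mul_le _ _).trans_lt ?_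
      refine (add_le_of_nonpos_left degree_C_le).trans_lt ?_
      refine degree_le_natDegree.trans_lt ?_
      rw [(ih k k.isLt).2]
      exact_mod_cast k.isLt
    rw [monicOP]
    refine ⟨monic_X_pow_sub hdeg, natDegree_eq_of_degree_eq_some ?_⟩
    rw [degree_sub_eq_left_of_degree_lt (by simpa using hdeg), degree_X_pow]

variable (σ : Measure Circle) [IsProbabilityMeasure σ]

/-- A nonzero polynomial cannot vanish `σ`-almost everywhere, as `σ` has infinite support. -/
theorem toL2_polyMap_ne_zero (hσ : σ.support.Infinite) {p : ℂ[X]} (hp : p ≠ 0) :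
    toL2 σ (polyMap p) ≠ 0 := by
  intro h0
  have hae : ∀ᵐ z : Circle ∂σ, p.eval (z : ℂ) = 0 := by
    have h1 := ContinuousMap.coeFn_toLp (p := 2) (𝕜 := ℂ) σ (polyMap p)
    have h2 : (fun z => toL2 σ (polyMap p) z) =ᵐ[σ] fun _ => 0 := by
      rw [h0]
      exact Lp.coeFn_zero ℂ 2 σ
    filter_upwards [h1, h2] with z hz1 hz2
    rw [← polyMap_apply, ← hz1]
    exact hz2
  have hfin : {z : Circle | p.eval (z : ℂ) = 0}.Finite := by
    have := (p.roots.toFinset.finite_toSet).preimage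
      (f := fun z : Circle => (z : ℂ)) Circle.coe_injective.injOn
    refine this.subset fun z hz => ?_
    simpa [hp] using hz
  exact hσ (hfin.subset (Measure.support_subset_of_isClosed hfin.isClosed hae))

/-- The norms `‖Φ_n‖_{2,σ}`. -/
noncomputable def opNorm (n : ℕ) : ℝ := ‖toL2 σ (polyMap (monicOP σ n))‖

theorem inner_polyMap_self (p : ℂ[X]) :
    polyInner σ p p = ((‖toL2 σ (polyMap p)‖ ^ 2 : ℝ) : ℂ) := by
  rw [polyInner_eq_inner, inner_self_eq_norm_sq_to_K]
  norm_cast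

theorem opNorm_pos (hσ : σ.support.Infinite) (n : ℕ) : 0 < opNorm σ n :=
  norm_pos_iff.2 (toL2_polyMap_ne_zero σ hσ (monicOP_monic σ n).1.ne_zero)

theorem inner_monicOP_of_lt (hσ : σ.support.Infinite) {k n : ℕ} (hk : k < n) :
    inner ℂ (toL2 σ (polyMap (monicOP σ k))) (toL2 σ (polyMap (monicOP σ n))) = 0 := by
  induction n using Nat.strong_induction_on generalizing k with
  | _ n ih =>
    rw [monicOP.eq_1 σ n]
    simp only [map_sub, map_sum, ← smul_eq_C_mul, map_smul, inner_sub_right, inner_sum,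
      inner_smul_right]
    rw [Finset.sum_eq_single (⟨k, hk⟩ : Fin n)]
    · have h1 := inner_polyMap_self σ (monicOP σ k)
      have h2 : polyInner σ (monicOP σ k) (monicOP σ k) ≠ 0 := by
        rw [h1]
        exact_mod_cast pow_ne_zero 2 (opNorm_pos σ hσ k).ne'
      rw [← polyInner_eq_inner, ← polyInner_eq_inner, div_mul_cancel₀ _ h2, sub_self]
    · intro l _ hl
      have hl' : (l : ℕ) ≠ k := fun h => hl (Fin.ext h)
      rcases lt_or_gt_of_ne hl' with h | h
      · rw [inner_eq_zero_symm.1 (ih k hk h), mul_zero]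
      · rw [ih l l.isLt h, mul_zero]
    · simp

/-- `Φ_n` is orthogonal to all polynomials of degree less than `n`. -/
theorem inner_polyMap_monicOP (hσ : σ.support.Infinite) {n : ℕ} {p : ℂ[X]} (hp : p.degree < n) :
    inner ℂ (toL2 σ (polyMap p)) (toL2 σ (polyMap (monicOP σ n))) = 0 := by
  suffices h : ∀ m ≤ n, ∀ p : ℂ[X], p.degree < m →
      inner ℂ (toL2 σ (polyMap p)) (toL2 σ (polyMap (monicOP σ n))) = 0 from h n le_rfl p hp
  intro m
  induction m with
  | zero =>
    intro _ p hp
    have : p = 0 := by simpa using hp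
    simp [this]
  | succ m ih =>
    intro hm p hp
    have hr : (p - C (p.coeff m) * monicOP σ m).degree < m := by
      rw [degree_lt_iff_coeff_zero] at hp ⊢
      intro i hi
      obtain ⟨hmon, hdeg⟩ := monicOP_monic σ m
      rw [coeff_sub, coeff_C_mul]
      rcases hi.eq_or_lt with rfl | hlt
      · have : (monicOP σ m).coeff m = 1 := by
          conv_lhs => rw [← hdeg]
          rw [hdeg]
          simpa [hdeg] using hmon.coeff_natDegree
        rw [this, mul_one, sub_self]
      · rw [hp i (by omega), coeff_eq_zero_of_natDegree_lt (hdeg.trans_lt hlt), mul_zero, sub_zero]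
    have h0 := ih (by omega) _ hr
    have h1 := inner_monicOP_of_lt σ hσ (show m < n by omega)
    rw [← smul_eq_C_mul, map_sub, map_sub, inner_sub_left, map_smul, map_smul, inner_smul_left,
      h1, mul_zero, sub_zero] at h0
    exact h0

/-- The reversed polynomial `z^n conj(Φ_n(1 / conj z))`: it has degree at most `n`, the value `1`
at `0` and the modulus of `Φ_n` on the circle. -/
theorem exists_reversed_monicOP (n : ℕ) : ∃ q : ℂ[X], q.natDegree ≤ n ∧ q.coeff 0 = 1 ∧
    ‖toL2 σ (polyMap q)‖ = opNorm σ n := by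
  obtain ⟨hmon, hdeg⟩ := monicOP_monic σ n
  set f := (monicOP σ n).map (starRingEnd ℂ) with hf
  have hfmon : f.Monic := hmon.map _
  have hfdeg : f.natDegree = n := by rw [hf, natDegree_map, hdeg]
  refine ⟨f.reverse, (reverse_natDegree_le f).trans hfdeg.le, ?_, ?_⟩
  · rw [coeff_zero_reverse, hfmon.leadingCoeff]
  · have hpt : ∀ z : Circle, ‖polyMap f.reverse z‖ = ‖polyMap (monicOP σ n) z‖ := by
      intro z
      let : Invertible ((starRingEnd ℂ) (z : ℂ)) := invertibleOfNonzero (by simp)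
      have h := eval₂_reverse_mul_pow (RingHom.id ℂ) ((starRingEnd ℂ) (z : ℂ)) f
      have hinv : ⅟((starRingEnd ℂ) (z : ℂ)) = z := by
        rw [invOf_eq_inv, ← Circle.coe_inv_eq_conj, Circle.coe_inv, inv_inv]
      rw [hinv, eval₂_id, eval₂_id, hf, eval_map, eval₂_hom] at h
      have h' := congrArg norm h
      rw [polyMap_apply, polyMap_apply]
      simpa [Circle.norm_coe] using h'
    refine (sq_eq_sq₀ (norm_nonneg _) (norm_nonneg _)).1 ?_
    rw [norm_toL2_sq, norm_toL2_sq]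
    simp only [hpt]

/-- The Szegő recurrence in the form of norms: `Φ_{n+1} - z Φ_n` has degree at most `n` and is
orthogonal to `z, …, z^n`, so that its norm is at most `|Φ_{n+1}(0)|` times that of any polynomial
of degree at most `n` with value `1` at `0`. -/
theorem opNorm_succ_sq (hσ : σ.support.Infinite) (n : ℕ) :
    opNorm σ (n + 1) ≤ opNorm σ n ∧
      (1 - ‖verblunsky σ n‖ ^ 2) * opNorm σ n ^ 2 ≤ opNorm σ (n + 1) ^ 2 := by
  set D : ℂ[X] := monicOP σ (n + 1) - X * monicOP σ n with hD
  obtain ⟨hm1, hd1⟩ := monicOP_monic σ (n + 1)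
  obtain ⟨hm0, hd0⟩ := monicOP_monic σ n
  have hXm : (X * monicOP σ n).Monic := monic_X.mul hm0
  have hXd : (X * monicOP σ n).natDegree = n + 1 := by
    rw [monic_X.natDegree_mul hm0, hd0, natDegree_X, add_comm]
  have hDdeg : D.degree < (n + 1 : ℕ) := by
    have h := degree_sub_lt_left (p := monicOP σ (n + 1)) (q := X * monicOP σ n) ?_ hm1.ne_zero ?_
    · rwa [degree_eq_natDegree hm1.ne_zero, hd1] at h
    · rw [degree_eq_natDegree hm1.ne_zero, degree_eq_natDegree hXm.ne_zero, hd1, hXd]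
    · rw [hm1.leadingCoeff, hXm.leadingCoeff]
  have hX : ∀ p : ℂ[X], polyMap (X * p) = zpowMap 1 * polyMap p := by
    intro p
    rw [map_mul]
    simp [polyMap]
  have horth : ∀ p : ℂ[X], p.degree < (n + 1 : ℕ) → p.coeff 0 = 0 →
      inner ℂ (toL2 σ (polyMap p)) (toL2 σ (polyMap D)) = 0 := by
    intro p hp hp0
    have hpX : X * p.divX = p := by
      conv_rhs => rw [← X_mul_divX_add p, hp0, C_0, add_zero]
    have hdiv : p.divX.degree < n := by
      rw [degree_lt_iff_coeff_zero] at hp ⊢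
      intro i hi
      rw [coeff_divX]
      exact hp _ (by omega)
    have h1 := inner_polyMap_monicOP σ hσ hp
    have h2 := inner_polyMap_monicOP σ hσ hdiv
    rw [hD, map_sub, map_sub, inner_sub_right, h1, zero_sub, neg_eq_zero, ← hpX, hX, hX,
      inner_zpowMap_mul, h2]
  obtain ⟨q, hq, hq0, hqn⟩ := exists_reversed_monicOP σ n
  have hD0 : ‖D.coeff 0‖ = ‖verblunsky σ n‖ := by
    simp [hD, verblunsky, coeff_zero_eq_eval_zero]
  have hDD : inner ℂ (toL2 σ (polyMap D)) (toL2 σ (polyMap D)) =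
      (starRingEnd ℂ) (D.coeff 0) * inner ℂ (toL2 σ (polyMap q)) (toL2 σ (polyMap D)) := by
    have h := horth (D - C (D.coeff 0) * q) ?_ (by simp [hq0])
    · rw [← smul_eq_C_mul, map_sub, map_sub, inner_sub_left, map_smul, map_smul,
        inner_smul_left] at h
      exact sub_eq_zero.1 h
    · refine (degree_sub_le _ _).trans_lt (max_lt hDdeg ?_)
      refine (degree_mul_le _ _).trans_lt ?_
      refine (add_le_of_nonpos_left degree_C_le).trans_lt ?_
      refine degree_le_natDegree.trans_lt ?_
      exact_mod_cast Nat.lt_succ_of_le hq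
  have hDle : ‖toL2 σ (polyMap D)‖ ≤ ‖verblunsky σ n‖ * opNorm σ n := by
    have h1 : ‖toL2 σ (polyMap D)‖ ^ 2 ≤
        ‖verblunsky σ n‖ * opNorm σ n * ‖toL2 σ (polyMap D)‖ := by
      have h2 := congrArg norm hDD
      rw [norm_mul, RCLike.norm_conj, hD0, inner_self_eq_norm_sq_to_K] at h2
      have h3 := norm_inner_le_norm (𝕜 := ℂ) (toL2 σ (polyMap q)) (toL2 σ (polyMap D))
      rw [hqn] at h3
      have h4 : ‖toL2 σ (polyMap D)‖ ^ 2 =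
          ‖verblunsky σ n‖ * ‖inner ℂ (toL2 σ (polyMap q)) (toL2 σ (polyMap D))‖ := by
        rw [← h2]; simp
      rw [h4, mul_assoc]
      gcongr
    rcases (norm_nonneg (toL2 σ (polyMap D))).eq_or_lt with h0 | h0
    · rw [← h0]
      exact mul_nonneg (norm_nonneg _) (norm_nonneg _)
    · rw [sq] at h1
      exact le_of_mul_le_mul_right h1 h0
  have hpyth : opNorm σ n ^ 2 = opNorm σ (n + 1) ^ 2 + ‖toL2 σ (polyMap D)‖ ^ 2 := by
    have h0 := inner_polyMap_monicOP σ hσ hDdeg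
    have h1 : toL2 σ (polyMap (X * monicOP σ n)) =
        toL2 σ (polyMap (monicOP σ (n + 1))) - toL2 σ (polyMap D) := by
      rw [hD, map_sub, map_sub, sub_sub_cancel]
    have h2 : ‖toL2 σ (polyMap (X * monicOP σ n))‖ = opNorm σ n := by
      rw [hX, norm_zpowMap_mul, opNorm]
    rw [← h2, h1, @norm_sub_sq ℂ, inner_eq_zero_symm.1 h0, opNorm]
    simp
  constructor
  · refine (sq_le_sq₀ (norm_nonneg _) (norm_nonneg _)).1 ?_
    have := sq_nonneg ‖toL2 σ (polyMap D)‖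
    change opNorm σ (n + 1) ^ 2 ≤ opNorm σ n ^ 2
    linarith
  · have h5 : ‖toL2 σ (polyMap D)‖ ^ 2 ≤ (‖verblunsky σ n‖ * opNorm σ n) ^ 2 := by gcongr
    rw [mul_pow] at h5
    linarith

end Polynomials

/-! ### Orthonormal polynomials and the defects of `s_n` -/

section Orthonormal

variable (σ : Measure Circle) [IsProbabilityMeasure σ]

/-- The orthonormal polynomials `φ_n` as continuous functions on the circle. -/
noncomputable def phiMap (n : ℕ) : C(Circle, ℂ) :=
  ((opNorm σ n : ℂ))⁻¹ • polyMap (monicOP σ n)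

theorem phiMap_apply (n : ℕ) (z : Circle) : phiMap σ n z = phi σ n z := by
  have h : (fun w : Circle => (monicOP σ n).eval (w : ℂ)) = polyMap (monicOP σ n) := by
    ext w
    rw [polyMap_apply]
  rw [phi, h, l2Norm_eq_norm_toL2, phiMap, opNorm, ContinuousMap.smul_apply, polyMap_apply,
    smul_eq_mul, div_eq_inv_mul]

theorem norm_phiMap (hσ : σ.support.Infinite) (n : ℕ) : ‖toL2 σ (phiMap σ n)‖ = 1 := by
  have h := opNorm_pos σ hσ n
  rw [phiMap, map_smul, norm_smul, norm_inv, Complex.norm_real, Real.norm_of_nonneg h.le]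
  exact inv_mul_cancel₀ h.ne'

theorem inner_zpowMap_mul_left (k : ℤ) (f g : C(Circle, ℂ)) :
    inner ℂ (toL2 σ (zpowMap k * f)) (toL2 σ g) =
      inner ℂ (toL2 σ f) (toL2 σ (zpowMap (-k) * g)) := by
  rw [← inner_zpowMap_mul σ (-k) (zpowMap k * f) g, ← mul_assoc, ← zpowMap_add, neg_add_cancel,
    zpowMap_zero, one_mul]

theorem inner_zpowMap_mul_zpowMap_mul (a b : ℤ) (f g : C(Circle, ℂ)) :
    inner ℂ (toL2 σ (zpowMap a * f)) (toL2 σ (zpowMap b * g)) =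
      inner ℂ (toL2 σ (zpowMap (a - b) * f)) (toL2 σ g) := by
  rw [← inner_zpowMap_mul σ b (zpowMap (a - b) * f) g, ← mul_assoc, ← zpowMap_add,
    add_sub_cancel]

/-- Orthogonality in Laurent form: the frequencies of `z^a φ_N` lie in `[a, a + N]`, and `z^b φ_M`
is orthogonal to the frequencies `b, …, b + M - 1`. -/
theorem inner_zpowMap_phiMap_eq_zero (hσ : σ.support.Infinite) {a b : ℤ} {N M : ℕ} (h1 : b ≤ a)
    (h2 : a + N < b + M) :
    inner ℂ (toL2 σ (zpowMap a * phiMap σ N)) (toL2 σ (zpowMap b * phiMap σ M)) = 0 := by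
  obtain ⟨k, hk⟩ := Int.eq_ofNat_of_zero_le (sub_nonneg.2 h1)
  obtain ⟨hm, hd⟩ := monicOP_monic σ N
  have hdeg : (X ^ k * monicOP σ N).degree < (M : WithBot ℕ) := by
    rw [degree_mul, degree_X_pow, degree_eq_natDegree hm.ne_zero, hd]
    exact_mod_cast (show k + N < M by omega)
  have h := inner_polyMap_monicOP σ hσ hdeg
  rw [map_mul, polyMap_X_pow] at h
  rw [inner_zpowMap_mul_zpowMap_mul, hk]
  simp only [phiMap, mul_smul_comm, map_smul, inner_smul_left, inner_smul_right]
  rw [h, mul_zero, mul_zero]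

/-- Both `z^k Φ_n` and `Φ_{n+k}` are monic of degree `n + k`, so that their difference is
orthogonal to `Φ_{n+k}`. -/
theorem inner_zpowMap_phiMap_phiMap (hσ : σ.support.Infinite) (n k : ℕ) :
    inner ℂ (toL2 σ (zpowMap k * phiMap σ n)) (toL2 σ (phiMap σ (n + k))) =
      ((opNorm σ (n + k) / opNorm σ n : ℝ) : ℂ) := by
  have hn := opNorm_pos σ hσ n
  have hnk := opNorm_pos σ hσ (n + k)
  obtain ⟨hm0, hd0⟩ := monicOP_monic σ n
  obtain ⟨hm1, hd1⟩ := monicOP_monic σ (n + k)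
  have hmX : (X ^ k * monicOP σ n).Monic := (monic_X_pow k).mul hm0
  have hdeg : (X ^ k * monicOP σ n).degree = ((n + k : ℕ) : WithBot ℕ) := by
    rw [degree_mul, degree_X_pow, degree_eq_natDegree hm0.ne_zero, hd0, add_comm n k]
    rfl
  have hdeg1 : (monicOP σ (n + k)).degree = ((n + k : ℕ) : WithBot ℕ) := by
    rw [degree_eq_natDegree hm1.ne_zero, hd1]
  have hlt : (X ^ k * monicOP σ n - monicOP σ (n + k)).degree <
      ((n + k : ℕ) : WithBot ℕ) := by
    have h := degree_sub_lt_left (hdeg.trans hdeg1.symm) hmX.ne_zero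
      (by rw [hmX.leadingCoeff, hm1.leadingCoeff])
    rwa [hdeg] at h
  have h := inner_polyMap_monicOP σ hσ hlt
  rw [map_sub, map_sub, inner_sub_left, map_mul, polyMap_X_pow, sub_eq_zero,
    ← polyInner_eq_inner σ (monicOP σ (n + k)) (monicOP σ (n + k)), inner_polyMap_self] at h
  simp only [phiMap, mul_smul_comm, map_smul, inner_smul_left, inner_smul_right]
  rw [h]
  change _ * (_ * ((opNorm σ (n + k) ^ 2 : ℝ) : ℂ)) = _
  rw [← Complex.ofReal_inv, ← Complex.ofReal_inv, Complex.conj_ofReal]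
  norm_cast
  field_simp

/-- The ratio `‖Φ_{n+k}‖² / ‖Φ_n‖²` is a product of factors `1 - |γ_i|²`, to which the inequality
`∏ (1 - x_i) ≥ 1 - ∑ x_i` applies. -/
theorem one_sub_sum_le_opNorm_div_sq (hσ : σ.support.Infinite) (n k : ℕ) :
    opNorm σ (n + k) / opNorm σ n ≤ 1 ∧
    1 - ∑ i ∈ Finset.Ico n (n + k), ‖verblunsky σ i‖ ^ 2 ≤
      (opNorm σ (n + k) / opNorm σ n) ^ 2 := by
  have hn := opNorm_pos σ hσ n
  induction k with
  | zero => simp [hn.ne']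
  | succ k ih =>
    obtain ⟨ih1, ih2⟩ := ih
    obtain ⟨h1, h2⟩ := opNorm_succ_sq σ hσ (n + k)
    have hnk := opNorm_pos σ hσ (n + k)
    refine ⟨le_trans ?_ ih1, ?_⟩
    · rw [← add_assoc]
      gcongr
    · rw [← add_assoc, Finset.sum_Ico_succ_top (by omega)]
      have h3 : (1 - ‖verblunsky σ (n + k)‖ ^ 2) * (opNorm σ (n + k) / opNorm σ n) ^ 2 ≤
          (opNorm σ (n + k + 1) / opNorm σ n) ^ 2 := by
        rw [div_pow, div_pow, ← mul_div_assoc]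
        gcongr
      have h4 : (opNorm σ (n + k) / opNorm σ n) ^ 2 ≤ 1 := pow_le_one₀ (by positivity) ih1
      nlinarith [sq_nonneg ‖verblunsky σ (n + k)‖]

/-- Advancing the index is almost multiplication by a power of `z`, as long as the Verblunsky
coefficients in between are small. -/
theorem norm_phiMap_sub_sq_le (hσ : σ.support.Infinite) (n k : ℕ) :
    ‖toL2 σ (phiMap σ (n + k) - zpowMap k * phiMap σ n)‖ ^ 2 ≤
      2 * ∑ i ∈ Finset.Ico n (n + k), ‖verblunsky σ i‖ ^ 2 := by
  obtain ⟨h1, h2⟩ := one_sub_sum_le_opNorm_div_sq σ hσ n k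
  have h0 : 0 ≤ opNorm σ (n + k) / opNorm σ n :=
    div_nonneg (norm_nonneg _) (norm_nonneg _)
  -- `‖φ_{n+k} - z^k φ_n‖² = 2 - 2t` with `t ≤ 1` and `t² ≥ 1 - ∑ |γ_i|²`, so that `t ≥ t²`.
  rw [map_sub, norm_sub_rev, @norm_sub_sq ℂ, inner_zpowMap_phiMap_phiMap σ hσ, norm_zpowMap_mul,
    norm_phiMap σ hσ, norm_phiMap σ hσ, RCLike.re_to_complex, Complex.ofReal_re]
  nlinarith

/-- The sum of `|γ_i|²` over the indices `i ≥ 0` with `N - R ≤ i < N + R`. -/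
noncomputable def gammaWindow (N R : ℕ) : ℝ :=
  ∑ i ∈ Finset.Ico (N - R) (N + R), ‖verblunsky σ i‖ ^ 2

/-- The measure `|φ_N|² dσ` is close to `m` for low frequencies: its `u`-th moment, `0 < u ≤ N`,
is of the second order in the Verblunsky coefficients, since it is the inner product of
`z^u φ_N - φ_{N+u}` and `φ_N - z^u φ_{N-u}`. -/
theorem norm_inner_zpowMap_phiMap_le (hσ : σ.support.Infinite) {N u : ℕ} (hu : 0 < u)
    (huN : u ≤ N) :
    ‖inner ℂ (toL2 σ (zpowMap u * phiMap σ N)) (toL2 σ (phiMap σ N))‖ ≤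
      2 * gammaWindow σ N u := by
  have hS : ∀ a b, Finset.Ico a b ⊆ Finset.Ico (N - u) (N + u) →
      ∑ i ∈ Finset.Ico a b, ‖verblunsky σ i‖ ^ 2 ≤ gammaWindow σ N u := fun a b hab =>
    Finset.sum_le_sum_of_subset_of_nonneg hab fun _ _ _ => by positivity
  have e1 := norm_phiMap_sub_sq_le σ hσ N u
  have e2 := norm_phiMap_sub_sq_le σ hσ (N - u) u
  rw [Nat.sub_add_cancel huN] at e2
  have s1 := hS N (N + u) (Finset.Ico_subset_Ico (by omega) le_rfl)
  have s2 := hS (N - u) N (Finset.Ico_subset_Ico le_rfl (by omega))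
  have z1 : inner ℂ (toL2 σ (phiMap σ N)) (toL2 σ (phiMap σ (N + u))) = 0 := by
    simpa using inner_zpowMap_phiMap_eq_zero σ hσ (a := 0) (b := 0) (N := N) (M := N + u) le_rfl
      (by push_cast; omega)
  have z2 : inner ℂ (toL2 σ (zpowMap u * phiMap σ (N - u))) (toL2 σ (phiMap σ (N + u))) = 0 := by
    simpa using inner_zpowMap_phiMap_eq_zero σ hσ (a := u) (b := 0) (N := N - u) (M := N + u)
      (by omega) (by push_cast; omega)
  have z3 : inner ℂ (toL2 σ (phiMap σ (N - u))) (toL2 σ (phiMap σ N)) = 0 := by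
    simpa using inner_zpowMap_phiMap_eq_zero σ hσ (a := 0) (b := 0) (N := N - u) (M := N) le_rfl
      (by omega)
  have key : inner ℂ (toL2 σ (phiMap σ N)) (toL2 σ (zpowMap u * phiMap σ N)) =
      -inner ℂ (toL2 σ (phiMap σ N - zpowMap u * phiMap σ (N - u)))
        (toL2 σ (phiMap σ (N + u) - zpowMap u * phiMap σ N)) := by
    rw [map_sub, map_sub, inner_sub_left, inner_sub_right, inner_sub_right, z1, z2,
      inner_zpowMap_mul, z3]
    ring
  rw [norm_inner_symm, key, norm_neg]
  refine (norm_inner_le_norm _ _).trans ?_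
  nlinarith [sq_nonneg (‖toL2 σ (phiMap σ N - zpowMap u * phiMap σ (N - u))‖ -
    ‖toL2 σ (phiMap σ (N + u) - zpowMap u * phiMap σ N)‖)]

/-- The functions `s_n`, extended by `s_0` to negative indices, as continuous functions. -/
noncomputable def sMap (n : ℤ) : C(Circle, ℂ) :=
  zpowMap (-(n.toNat : ℤ)) * phiMap σ (2 * n.toNat)

theorem sMap_apply (n : ℤ) (z : Circle) : sMap σ n z = s σ n.toNat z := by
  simp [sMap, s, zpowMap_apply, phiMap_apply]

theorem norm_sMap (hσ : σ.support.Infinite) (n : ℤ) : ‖toL2 σ (sMap σ n)‖ = 1 := by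
  rw [sMap, norm_zpowMap_mul, norm_phiMap σ hσ]

/-- The defect `s_{n+u} - z^u s_n`. -/
noncomputable def defect (n : ℕ) (u : ℤ) : C(Circle, ℂ) :=
  sMap σ (n + u) - zpowMap u * sMap σ n

theorem norm_defect_sq_le (hσ : σ.support.Infinite) {n : ℕ} {u : ℤ} (hu : |u| ≤ n) :
    ‖toL2 σ (defect σ n u)‖ ^ 2 ≤ 2 * gammaWindow σ (2 * n) (2 * u.natAbs) := by
  rcases le_total 0 u with h | h
  · lift u to ℕ using h
    have e : defect σ n u =
        zpowMap (-((n : ℤ) + u)) *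
          (phiMap σ (2 * n + 2 * u) - zpowMap (2 * u : ℕ) * phiMap σ (2 * n)) := by
      rw [defect, sMap, sMap, mul_sub, ← mul_assoc, ← mul_assoc, ← zpowMap_add, ← zpowMap_add,
        ← Nat.cast_add, Int.toNat_natCast, Int.toNat_natCast, mul_add]
      congr 3
      push_cast
      ring
    rw [e, norm_zpowMap_mul]
    refine (norm_phiMap_sub_sq_le σ hσ _ _).trans ?_
    rw [gammaWindow, Int.natAbs_natCast]
    gcongr
    omega
  · obtain ⟨v, rfl⟩ := Int.exists_eq_neg_ofNat h
    have hv : v ≤ n := by simpa using hu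
    obtain ⟨m, rfl⟩ := Nat.exists_eq_add_of_le' hv
    have e : defect σ (m + v) (-v) =
        (-1 : ℂ) • (zpowMap (-((m : ℤ) + v + v)) *
          (phiMap σ (2 * m + 2 * v) - zpowMap (2 * v : ℕ) * phiMap σ (2 * m))) := by
      rw [defect, sMap, sMap, mul_sub, ← mul_assoc, ← mul_assoc, ← zpowMap_add, ← zpowMap_add,
        Nat.cast_add, add_neg_cancel_right, ← Nat.cast_add, Int.toNat_natCast,
        Int.toNat_natCast, mul_add, neg_one_smul, neg_sub]
      congr 3 <;> push_cast <;> ring_nf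
    rw [e, map_smul, norm_smul, norm_neg, norm_one, one_mul, norm_zpowMap_mul]
    refine (norm_phiMap_sub_sq_le σ hσ _ _).trans ?_
    rw [gammaWindow, Int.natAbs_neg, Int.natAbs_natCast]
    gcongr
    · omega
    · omega

/-- The defect `s_{n+u} - z^u s_n` has its frequencies in `[-(n + |u|), n + |u|]` and is orthogonal
to those in `[-(n - |u|), n - |u| - 1]`. Hence the defects at indices further apart than
`|u| + |v|` are orthogonal. -/
theorem inner_defect_eq_zero (hσ : σ.support.Infinite) {n m : ℕ} {u v : ℤ} (hu : |u| ≤ n)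
    (hv : |v| ≤ m) (h : |u| + |v| < |(m : ℤ) - n|) :
    inner ℂ (toL2 σ (defect σ n u)) (toL2 σ (defect σ m v)) = 0 := by
  wlog hnm : n ≤ m generalizing n m u v
  · rw [inner_eq_zero_symm]
    exact this hv hu (by rwa [add_comm, abs_sub_comm]) (le_of_not_ge hnm)
  rw [abs_of_nonneg (show (0 : ℤ) ≤ (m : ℤ) - n by omega)] at h
  have bu := abs_le.1 (le_refl |u|)
  have bv := abs_le.1 (le_refl |v|)
  obtain ⟨p, hp⟩ := Int.eq_ofNat_of_zero_le (show 0 ≤ (n : ℤ) + u by omega)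
  obtain ⟨q, hq⟩ := Int.eq_ofNat_of_zero_le (show 0 ≤ (m : ℤ) + v by omega)
  have hp' : (p : ℤ) = n + u := hp.symm
  have hq' : (q : ℤ) = m + v := hq.symm
  simp only [defect, sMap, hp, hq, Int.toNat_natCast,
    ← mul_assoc, ← zpowMap_add, map_sub, inner_sub_left, inner_sub_right]
  rw [inner_zpowMap_phiMap_eq_zero σ hσ, inner_zpowMap_phiMap_eq_zero σ hσ,
    inner_zpowMap_phiMap_eq_zero σ hσ, inner_zpowMap_phiMap_eq_zero σ hσ]
  · ring
  all_goals push_cast; omega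

end Orthonormal

/-! ### Frequency weights -/

section Weights

/-- The weight `1 + |u| / κ` measuring a frequency `u` on the scale `κ`. -/
noncomputable def freqWeight (κ : ℕ) (u : ℤ) : ℝ := 1 + |(u : ℝ)| / κ

theorem one_le_freqWeight (κ : ℕ) (u : ℤ) : 1 ≤ freqWeight κ u := by
  rw [freqWeight]
  have : 0 ≤ |(u : ℝ)| / κ := by positivity
  linarith

theorem freqWeight_pos (κ : ℕ) (u : ℤ) : 0 < freqWeight κ u :=
  zero_lt_one.trans_le (one_le_freqWeight κ u)

theorem summable_inv_freqWeight_sq_aux {κ : ℕ} (hκ : 0 < κ) {f : ℕ → ℝ} (hf0 : ∀ n, 0 ≤ f n)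
    (hf : ∀ n : ℕ, f n ≤ 1 / (κ * freqWeight κ n ^ 2)) : Summable f ∧ ∑' n, f n ≤ 2 := by
  have hκ' : (1 : ℝ) ≤ κ := by exact_mod_cast hκ
  -- The comparison `κ / (κ + n)² ≤ 2κ / ((κ + n)(κ + n + 1))` makes the sum telescope.
  have hsum : ∀ N : ℕ, ∑ n ∈ Finset.range N, f n ≤ 2 * (1 - κ / (κ + N)) := by
    intro N
    induction N with
    | zero => simp [show (κ : ℝ) ≠ 0 by positivity]
    | succ N ih =>
      rw [Finset.sum_range_succ]
      have h1 : f N ≤ 2 * (κ / (κ + N) - κ / (κ + (N + 1))) := by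
        refine (hf N).trans ?_
        have e : 2 * (κ / (κ + N) - κ / (κ + (N + 1))) =
            2 * (κ : ℝ) / ((κ + N) * (κ + (N + 1))) := by
          field_simp
          ring
        have e2 : 1 / (κ * freqWeight κ N ^ 2) = (κ : ℝ) / ((κ + N) * (κ + N)) := by
          rw [freqWeight, Int.cast_natCast, abs_of_nonneg (by positivity)]
          field_simp
        rw [e, e2, div_le_div_iff₀ (by positivity) (by positivity)]
        have : (0 : ℝ) ≤ N := by positivity
        have h2 : (κ : ℝ) + (N + 1) ≤ 2 * (κ + N) := by linarith
        have h3 : 0 ≤ (κ : ℝ) * (κ + N) := by positivity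
        nlinarith
      push_cast
      linarith
  have hle : ∀ N : ℕ, ∑ n ∈ Finset.range N, f n ≤ 2 := fun N =>
    (hsum N).trans (by have : (0 : ℝ) ≤ κ / (κ + N) := by positivity
                       linarith)
  exact ⟨summable_of_sum_range_le hf0 hle, Real.tsum_le_of_sum_range_le hf0 hle⟩

/-- The sums `∑_u κ⁻¹ (1 + |u| / κ)⁻²` are bounded uniformly in `κ`. -/
theorem summable_inv_freqWeight_sq {κ : ℕ} (hκ : 0 < κ) :
    Summable (fun u : ℤ => 1 / (κ * freqWeight κ u ^ 2)) ∧
      ∑' u : ℤ, 1 / (κ * freqWeight κ u ^ 2) ≤ 4 := by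
  set F : ℤ → ℝ := fun u => 1 / (κ * freqWeight κ u ^ 2) with hF
  have hnn : ∀ u : ℤ, 0 ≤ F u := fun u => by
    have := freqWeight_pos κ u
    simp only [hF]
    positivity
  have hneg : ∀ n : ℕ, F (-((n : ℤ) + 1)) ≤ F n := fun n => by
    have h0 := freqWeight_pos κ n
    have : freqWeight κ n ≤ freqWeight κ (-((n : ℤ) + 1)) := by
      rw [freqWeight, freqWeight]
      push_cast
      rw [abs_neg, abs_of_nonneg (by positivity), abs_of_nonneg (by positivity)]
      gcongr
      linarith
    have : (0 : ℝ) < κ := by positivity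
    simp only [hF]
    gcongr
  obtain ⟨s1, t1⟩ := summable_inv_freqWeight_sq_aux hκ (f := fun n : ℕ => F n)
    (fun n => hnn n) fun n => le_rfl
  obtain ⟨s2, t2⟩ := summable_inv_freqWeight_sq_aux hκ (f := fun n : ℕ => F (-((n : ℤ) + 1)))
    (fun n => hnn _) hneg
  have h : HasSum F _ := HasSum.of_nat_of_neg_add_one s1.hasSum s2.hasSum
  exact ⟨h.summable, h.tsum_eq.trans_le (by linarith)⟩

end Weights

/-! ### Fourier expansion of the bumps -/

section Bumps

theorem integral_arcMeasure {F : Circle → ℂ} (hF : Measurable F) :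
    ∫ z, F z ∂arcMeasure =
      ((1 / (2 * Real.pi) : ℝ) : ℂ) * ∫ x in (-Real.pi)..Real.pi, F (Circle.exp x) := by
  have hm : Measurable Circle.exp := Circle.exp.continuous.measurable
  rw [arcMeasure, integral_smul_measure, integral_map hm.aemeasurable hF.aestronglyMeasurable,
    intervalIntegral.integral_of_le (by linarith [Real.pi_pos]),
    ENNReal.toReal_ofReal (by positivity), Complex.real_smul]

theorem measurable_bump {h : ℝ → ℝ} (hh : Continuous h) (κ j : ℕ) : Measurable (bump h κ j) := by
  unfold bump
  have hc : Continuous fun z : Circle => ((z / root κ j : Circle) : ℂ) :=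
    continuous_subtype_val.comp (continuous_id.div' continuous_const)
  have : Measurable fun z : Circle => ((z / root κ j : Circle) : ℂ) := hc.measurable
  exact hh.measurable.comp ((Complex.measurable_arg.comp this).const_mul _)

theorem bump_eq_bump_zero (h : ℝ → ℝ) (κ j : ℕ) (z : Circle) :
    bump h κ j z = bump h κ 0 (z / root κ j) := by
  simp [bump, root]

/-- Rotation invariance of `m`. -/
theorem bumpCoeff_eq_mul (h : ℝ → ℝ) (hh : Continuous h) (κ j : ℕ) (u : ℤ) :
    bumpCoeff h κ j u = (root κ j : ℂ) ^ (-u) * bumpCoeff h κ 0 u := by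
  have hmeas : ∀ j, Measurable fun z : Circle => (bump h κ j z : ℂ) * (z : ℂ) ^ (-u) := fun j => by
    refine (Complex.measurable_ofReal.comp (measurable_bump hh κ j)).mul ?_
    simpa only [← zpowMap_apply] using (zpowMap (-u)).continuous.measurable
  set θ : ℝ := 2 * Real.pi * j / κ with hθ
  let G : ℝ → ℂ := fun x => (bump h κ 0 (Circle.exp x) : ℂ) * (Circle.exp x : ℂ) ^ (-u)
  have hper : Function.Periodic G (2 * Real.pi) := fun x => by
    simp only [G, Circle.periodic_exp x]
  have hpt : ∀ x : ℝ, (bump h κ j (Circle.exp x) : ℂ) * (Circle.exp x : ℂ) ^ (-u) =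
      (root κ j : ℂ) ^ (-u) * G (x - θ) := by
    intro x
    have e : Circle.exp (x - θ) = Circle.exp x / root κ j := by
      rw [Circle.exp_sub, root]
    have hne := (root κ j).coe_ne_zero
    simp only [G]
    rw [bump_eq_bump_zero, e, Circle.coe_div, div_zpow]
    have : (root κ j : ℂ) ^ (-u) ≠ 0 := zpow_ne_zero _ hne
    field_simp
  rw [bumpCoeff, bumpCoeff, integral_arcMeasure (hmeas j), integral_arcMeasure (hmeas 0)]
  simp_rw [hpt]
  rw [intervalIntegral.integral_const_mul, intervalIntegral.integral_comp_sub_right G θ]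
  have := hper.intervalIntegral_add_eq (-Real.pi - θ) (-Real.pi)
  rw [show -Real.pi - θ + 2 * Real.pi = Real.pi - θ by ring,
    show -Real.pi + 2 * Real.pi = Real.pi by ring] at this
  rw [this]
  simp only [G]
  ring

theorem eq_zero_of_two_pi_lt {h : ℝ → ℝ}
    (h_supp : tsupport h ⊆ Set.Icc (-(2 * Real.pi)) (2 * Real.pi)) {x : ℝ}
    (hx : 2 * Real.pi < |x|) : h x = 0 := by
  by_contra hne
  have := h_supp (subset_tsupport _ hne)
  exact absurd (abs_le.2 this) (not_le.2 hx)

/-- The smooth compactly supported function `t ↦ h (c t)`, `c ≠ 0`, as a Schwartz function. -/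
noncomputable def dilate (h : ℝ → ℝ) (h_smooth : ContDiff ℝ ∞ h)
    (h_comp : HasCompactSupport h) (c : ℝ) (hc : c ≠ 0) : SchwartzMap ℝ ℂ :=
  HasCompactSupport.toSchwartzMap (f := fun t => (h (c * t) : ℂ))
    ((h_comp.comp_homeomorph (Homeomorph.mulLeft₀ c hc)).comp_left Complex.ofReal_zero)
    (Complex.ofRealCLM.contDiff.comp (h_smooth.comp (contDiff_const.mul contDiff_id)))

theorem dilate_apply (h : ℝ → ℝ) (h_smooth : ContDiff ℝ ∞ h)
    (h_comp : HasCompactSupport h) (c : ℝ) (hc : c ≠ 0) (t : ℝ) :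
    dilate h h_smooth h_comp c hc t = h (c * t) := rfl

open FourierTransform in
theorem fourier_dilate (h : ℝ → ℝ) (h_smooth : ContDiff ℝ ∞ h)
    (h_comp : HasCompactSupport h) (c : ℝ) (hc : 0 < c) (ξ : ℝ) :
    𝓕 (dilate h h_smooth h_comp c hc.ne') ξ =
      (c : ℂ)⁻¹ * 𝓕 (dilate h h_smooth h_comp 1 one_ne_zero) (ξ / c) := by
  rw [SchwartzMap.fourier_coe, SchwartzMap.fourier_coe, Real.fourier_real_eq_integral_exp_smul,
    Real.fourier_real_eq_integral_exp_smul]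
  simp only [dilate_apply, one_mul]
  have := MeasureTheory.Measure.integral_comp_mul_left
    (fun v : ℝ => Complex.exp (((-2 * Real.pi * v * (ξ / c) : ℝ) : ℂ) * Complex.I) • (h v : ℂ)) c
  rw [abs_of_pos (inv_pos.2 hc), Complex.real_smul, Complex.ofReal_inv] at this
  rw [← this]
  congr 1
  ext v
  congr 4
  field_simp

open FourierTransform in
/-- The Fourier coefficients of `ω_0` are the values of the Fourier transform of `t ↦ h (2πκt)`
at the integers, because this function is supported in a single period. -/
theorem bumpCoeff_zero_eq_fourier (h : ℝ → ℝ) (h_smooth : ContDiff ℝ ∞ h)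
    (h_comp : HasCompactSupport h)
    (h_supp : tsupport h ⊆ Set.Icc (-(2 * Real.pi)) (2 * Real.pi)) {κ : ℕ} (hκ : 3 ≤ κ)
    (hc : 2 * Real.pi * κ ≠ 0) (u : ℤ) :
    bumpCoeff h κ 0 u = 𝓕 (dilate h h_smooth h_comp (2 * Real.pi * κ) hc) u := by
  have hpi := Real.pi_pos
  have hκ' : (3 : ℝ) ≤ κ := by exact_mod_cast hκ
  have hmeas : Measurable fun z : Circle => (bump h κ 0 z : ℂ) * (z : ℂ) ^ (-u) := by
    refine (Complex.measurable_ofReal.comp (measurable_bump h_smooth.continuous κ 0)).mul ?_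
    simpa only [← zpowMap_apply] using (zpowMap (-u)).continuous.measurable
  have hpt : ∀ x ∈ Set.Ioc (-Real.pi) Real.pi,
      (bump h κ 0 (Circle.exp x) : ℂ) * (Circle.exp x : ℂ) ^ (-u) =
        Complex.exp (((-x * u : ℝ) : ℂ) * Complex.I) * (h (κ * x) : ℂ) := by
    intro x hx
    have e : Complex.arg ((Circle.exp x / root κ 0 : Circle) : ℂ) = x := by
      simp only [root, Nat.cast_zero, mul_zero, zero_div, Circle.exp_zero, div_one]
      exact Circle.arg_exp hx.1 hx.2
    rw [bump, e, Circle.coe_exp, ← Complex.exp_int_mul, mul_comm]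
    congr 2
    push_cast
    ring
  have hout : ∀ x ∉ Set.Ioc (-Real.pi) Real.pi,
      Complex.exp (((-x * u : ℝ) : ℂ) * Complex.I) * (h (κ * x) : ℂ) = 0 := by
    intro x hx
    have hx' : Real.pi ≤ |x| := by
      by_contra hlt
      have := abs_lt.1 (not_le.1 hlt)
      exact hx ⟨this.1, this.2.le⟩
    rw [eq_zero_of_two_pi_lt h_supp, Complex.ofReal_zero, mul_zero]
    rw [abs_mul, Nat.abs_cast]
    nlinarith
  rw [bumpCoeff, integral_arcMeasure hmeas, intervalIntegral.integral_of_le (by linarith),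
    setIntegral_congr_fun measurableSet_Ioc hpt,
    setIntegral_eq_integral_of_forall_compl_eq_zero hout, SchwartzMap.fourier_coe,
    Real.fourier_real_eq_integral_exp_smul]
  have := MeasureTheory.Measure.integral_comp_mul_left
    (fun x : ℝ => Complex.exp (((-x * u : ℝ) : ℂ) * Complex.I) * (h (κ * x) : ℂ)) (2 * Real.pi)
  rw [abs_of_pos (by positivity), Complex.real_smul, ← one_div] at this
  rw [← this]
  congr 1
  ext v
  rw [dilate_apply, smul_eq_mul, show -2 * Real.pi * v * (u : ℝ) = -(2 * Real.pi * v) * u by ring,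
    show 2 * Real.pi * κ * v = κ * (2 * Real.pi * v) by ring]

open FourierTransform in
/-- Rapid decay of the Fourier coefficients of the bumps on the scale `κ`. -/
theorem exists_norm_bumpCoeff_le (h : ℝ → ℝ) (h_smooth : ContDiff ℝ ∞ h)
    (h_supp : tsupport h ⊆ Set.Icc (-(2 * Real.pi)) (2 * Real.pi)) :
    ∃ K : ℝ, 0 ≤ K ∧ ∀ κ : ℕ, 3 ≤ κ → ∀ j u,
      ‖bumpCoeff h κ j u‖ ≤ K / (κ * freqWeight κ u ^ 5) := by
  have hpi := Real.pi_pos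
  have h_comp : HasCompactSupport h :=
    isCompact_Icc.of_isClosed_subset (isClosed_tsupport h) h_supp
  set g := 𝓕 (dilate h h_smooth h_comp 1 one_ne_zero) with hg
  obtain ⟨K, hK0, hK⟩ : ∃ K, 0 ≤ K ∧ ∀ ξ, (1 + ‖ξ‖) ^ 5 * ‖g ξ‖ ≤ K := by
    refine ⟨2 ^ 5 * ((Finset.Iic (5, 0)).sup fun m => SchwartzMap.seminorm ℂ m.1 m.2) g,
      by positivity, fun ξ => ?_⟩
    have := SchwartzMap.one_add_le_sup_seminorm_apply (𝕜 := ℂ) (m := (5, 0)) (k := 5) (n := 0)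
      le_rfl le_rfl g ξ
    rwa [norm_iteratedFDeriv_zero] at this
  refine ⟨7 ^ 5 * K, by positivity, fun κ hκ j u => ?_⟩
  have hκ' : (3 : ℝ) ≤ κ := by exact_mod_cast hκ
  have hc : 0 < 2 * Real.pi * κ := by positivity
  have hw := freqWeight_pos κ u
  rw [bumpCoeff_eq_mul h h_smooth.continuous, norm_mul, norm_zpow, Circle.norm_coe, one_zpow,
    one_mul, bumpCoeff_zero_eq_fourier h h_smooth h_comp h_supp hκ hc.ne',
    fourier_dilate h h_smooth h_comp _ hc,
    norm_mul, norm_inv, Complex.norm_real, Real.norm_of_nonneg hc.le]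
  set ξ : ℝ := u / (2 * Real.pi * κ) with hξ
  have h1 : freqWeight κ u ≤ 7 * (1 + ‖ξ‖) := by
    have e : |(u : ℝ)| / κ = 2 * Real.pi * ‖ξ‖ := by
      rw [hξ, Real.norm_eq_abs, abs_div, abs_of_pos hc]
      field_simp
    rw [freqWeight, e]
    nlinarith [Real.pi_lt_d2, norm_nonneg ξ]
  have h2 : freqWeight κ u ^ 5 * ‖g ξ‖ ≤ 7 ^ 5 * K := by
    calc freqWeight κ u ^ 5 * ‖g ξ‖ ≤ (7 * (1 + ‖ξ‖)) ^ 5 * ‖g ξ‖ := by gcongr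
      _ = 7 ^ 5 * ((1 + ‖ξ‖) ^ 5 * ‖g ξ‖) := by ring
      _ ≤ 7 ^ 5 * K := by gcongr; exact hK ξ
  rw [le_div_iff₀ (by positivity)]
  have h3 : (2 * Real.pi * (κ : ℝ))⁻¹ * κ ≤ 1 := by
    rw [inv_mul_le_one₀ hc]
    nlinarith [Real.pi_gt_three]
  calc (2 * Real.pi * (κ : ℝ))⁻¹ * ‖g ξ‖ * (κ * freqWeight κ u ^ 5)
      = ((2 * Real.pi * (κ : ℝ))⁻¹ * κ) * (freqWeight κ u ^ 5 * ‖g ξ‖) := by ring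
    _ ≤ 1 * (7 ^ 5 * K) := by gcongr
    _ = 7 ^ 5 * K := one_mul _

theorem summable_norm_bumpCoeff (h : ℝ → ℝ) (h_smooth : ContDiff ℝ ∞ h)
    (h_supp : tsupport h ⊆ Set.Icc (-(2 * Real.pi)) (2 * Real.pi)) {κ : ℕ} (hκ : 3 ≤ κ) (j : ℕ) :
    Summable fun u => ‖bumpCoeff h κ j u‖ := by
  obtain ⟨K, hK0, hK⟩ := exists_norm_bumpCoeff_le h h_smooth h_supp
  refine Summable.of_nonneg_of_le (fun _ => norm_nonneg _) (fun u => ?_)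
    ((summable_inv_freqWeight_sq (κ := κ) (by omega)).1.mul_left K)
  refine (hK κ hκ j u).trans ?_
  rw [mul_one_div]
  have h0 := freqWeight_pos κ u
  have : (0 : ℝ) < κ := by exact_mod_cast (show 0 < κ by omega)
  have := one_le_freqWeight κ u
  gcongr
  norm_num

/-- The Fourier expansion of the bumps: Poisson summation for `t ↦ h (2πκt)`. -/
theorem hasSum_bumpCoeff (h : ℝ → ℝ) (h_smooth : ContDiff ℝ ∞ h)
    (h_supp : tsupport h ⊆ Set.Icc (-(2 * Real.pi)) (2 * Real.pi)) {κ : ℕ} (hκ : 3 ≤ κ) (j : ℕ)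
    (z : Circle) :
    HasSum (fun u : ℤ => bumpCoeff h κ j u * (z : ℂ) ^ u) (bump h κ j z : ℂ) := by
  have hpi := Real.pi_pos
  have h_comp : HasCompactSupport h :=
    isCompact_Icc.of_isClosed_subset (isClosed_tsupport h) h_supp
  have hκ' : (3 : ℝ) ≤ κ := by exact_mod_cast hκ
  have hc : 0 < 2 * Real.pi * κ := by positivity
  have hs : Summable fun u : ℤ => bumpCoeff h κ j u * (z : ℂ) ^ u := by
    refine Summable.of_norm ?_
    simpa only [norm_mul, norm_zpow, Circle.norm_coe, one_zpow, mul_one] using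
      summable_norm_bumpCoeff h h_smooth h_supp hκ j
  set w : Circle := z / root κ j with hw
  set a : ℝ := Complex.arg (w : ℂ) with ha
  have hP := SchwartzMap.tsum_eq_tsum_fourier (dilate h h_smooth h_comp _ hc.ne')
    (a / (2 * Real.pi))
  -- Only the translate `n = 0` meets the support: for `n ≠ 0` the argument of `h` is at least
  -- `κ π > 2 π` in absolute value.
  have hL : ∑' n : ℤ, dilate h h_smooth h_comp _ hc.ne' (a / (2 * Real.pi) + n) =
      (bump h κ j z : ℂ) := by
    rw [tsum_eq_single 0]
    · rw [dilate_apply, bump]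
      rw [← hw, ← ha, show 2 * Real.pi * κ * (a / (2 * Real.pi) + ((0 : ℤ) : ℝ)) = κ * a by
        push_cast
        field_simp
        ring]
    · intro n hn
      rw [dilate_apply, eq_zero_of_two_pi_lt h_supp, Complex.ofReal_zero]
      have e : 2 * Real.pi * κ * (a / (2 * Real.pi) + n) = κ * (a + 2 * Real.pi * n) := by
        field_simp
      have h1 : |a| ≤ Real.pi := Complex.abs_arg_le_pi _
      have h2 : (1 : ℝ) ≤ |(n : ℝ)| := by exact_mod_cast Int.one_le_abs hn
      have h3 : Real.pi ≤ |a + 2 * Real.pi * n| := by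
        have := abs_sub_abs_le_abs_sub (2 * Real.pi * (n : ℝ)) (-a)
        rw [abs_neg, sub_neg_eq_add, add_comm _ a, abs_mul, abs_of_pos (by positivity)] at this
        nlinarith
      rw [e, abs_mul, Nat.abs_cast]
      nlinarith
  convert! hs.hasSum using 1
  rw [← hL, hP]
  congr 1
  ext u
  rw [← bumpCoeff_zero_eq_fourier h h_smooth h_comp h_supp hκ,
    bumpCoeff_eq_mul h h_smooth.continuous κ j, fourier_coe_apply]
  have e1 : Complex.exp
      (2 * Real.pi * Complex.I * u * ((a / (2 * Real.pi) : ℝ) : ℂ) / ((1 : ℝ) : ℂ)) =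
      (w : ℂ) ^ u := by
    have e2 : (w : ℂ) = Complex.exp (a * Complex.I) := by
      have := Complex.norm_mul_exp_arg_mul_I (w : ℂ)
      rw [Circle.norm_coe, Complex.ofReal_one, one_mul] at this
      exact this.symm
    rw [e2, ← Complex.exp_int_mul]
    congr 1
    have : (Real.pi : ℂ) ≠ 0 := by exact_mod_cast hpi.ne'
    push_cast
    field_simp
  rw [e1, hw, Circle.coe_div, div_zpow, zpow_neg]
  ring

end Bumps

/-! ### Overlap of the windows of Verblunsky coefficients -/

section Counting

/-- At most `1 + 2R / c` multiples of `c` lie within distance `R` of a given point. -/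
theorem card_le_of_abs_sub_mul_le {J : Finset ℕ} {c R x : ℝ} (hc : 0 < c) (hR : 0 ≤ R)
    (hJ : ∀ j ∈ J, |x - c * j| ≤ R) : (J.card : ℝ) ≤ 1 + 2 * R / c := by
  rcases J.eq_empty_or_nonempty with rfl | hne
  · simp only [Finset.card_empty, Nat.cast_zero]
    positivity
  · have hsub : J ⊆ Finset.Icc (J.min' hne) (J.max' hne) := fun j hj =>
      Finset.mem_Icc.2 ⟨J.min'_le j hj, J.le_max' j hj⟩
    have hcard := Finset.card_le_card hsub
    rw [Nat.card_Icc] at hcard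
    have hle := J.min'_le _ (J.max'_mem hne)
    have h1 := abs_le.1 (hJ _ (J.min'_mem hne))
    have h2 := abs_le.1 (hJ _ (J.max'_mem hne))
    have h3 : (J.card : ℝ) + J.min' hne ≤ J.max' hne + 1 := by
      exact_mod_cast (show J.card + J.min' hne ≤ J.max' hne + 1 by omega)
    have h4 : (J.max' hne : ℝ) - J.min' hne ≤ 2 * R / c := by
      rw [le_div_iff₀ hc]
      nlinarith
    linarith

variable (σ : Measure Circle)

/-- The tail of `∑ |γ_i|²` beyond `κ²`, plus `κ⁻¹` times the whole sum: this bounds, up to powers of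
the frequency weight, the sums of `|γ_i|²` over all the windows in use. -/
noncomputable def gammaTail (κ : ℕ) : ℝ :=
  (∑' i, ‖verblunsky σ (i + κ ^ 2)‖ ^ 2) + (∑' i, ‖verblunsky σ i‖ ^ 2) / κ

theorem gammaTail_nonneg (κ : ℕ) : 0 ≤ gammaTail σ κ :=
  add_nonneg (tsum_nonneg fun _ => by positivity)
    (div_nonneg (tsum_nonneg fun _ => by positivity) (by positivity))

theorem tendsto_gammaTail : Tendsto (gammaTail σ) atTop (𝓝 0) := by
  have h1 : Tendsto (fun κ : ℕ => ∑' i, ‖verblunsky σ (i + κ ^ 2)‖ ^ 2) atTop (𝓝 0) :=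
    (tendsto_sum_nat_add fun i => ‖verblunsky σ i‖ ^ 2).comp
      (tendsto_pow_atTop two_ne_zero)
  have h2 : Tendsto (fun κ : ℕ => (∑' i, ‖verblunsky σ i‖ ^ 2) / (κ : ℝ)) atTop (𝓝 0) :=
    tendsto_const_nhds.div_atTop tendsto_natCast_atTop_atTop
  simpa [gammaTail] using! h1.add h2

/-- The windows of radius `R` around `2(κ² + 2jκ)`, `j < κ`, have overlap at most `1 + R / κ`, and
for `R ≤ κ²` they lie to the right of `κ²`. -/
theorem sum_gammaWindow_le (hγ : Summable fun n => ‖verblunsky σ n‖ ^ 2) {κ : ℕ} (hκ : 0 < κ)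
    (R : ℕ) :
    ∑ j ∈ Finset.range κ, gammaWindow σ (2 * (κ ^ 2 + 2 * j * κ)) R ≤
      (1 + (R : ℝ) / κ) ^ 2 * gammaTail σ κ := by
  have hκ' : (0 : ℝ) < κ := by exact_mod_cast hκ
  set g : ℕ → ℝ := fun i => ‖verblunsky σ i‖ ^ 2 with hg
  have hg0 : ∀ i, 0 ≤ g i := fun i => by positivity
  let W : ℕ → Finset ℕ := fun j =>
    Finset.Ico (2 * (κ ^ 2 + 2 * j * κ) - R) (2 * (κ ^ 2 + 2 * j * κ) + R)
  set U := (Finset.range κ).biUnion W with hU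
  have hcount : ∀ i, (((Finset.range κ).filter fun j => i ∈ W j).card : ℝ) ≤ 1 + (R : ℝ) / κ := by
    intro i
    have h := card_le_of_abs_sub_mul_le (J := (Finset.range κ).filter fun j => i ∈ W j)
      (c := 4 * κ) (R := R) (x := (i : ℝ) - 2 * κ ^ 2) (by positivity) (by positivity) ?_
    · refine h.trans ?_
      have : 2 * (R : ℝ) / (4 * κ) ≤ R / κ := by
        rw [div_le_div_iff₀ (by positivity) hκ']
        nlinarith [mul_nonneg (Nat.cast_nonneg (α := ℝ) R) hκ'.le]
      linarith
    · intro j hj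
      have hj' := Finset.mem_Ico.1 (Finset.mem_filter.1 hj).2
      have h1 : 2 * (κ ^ 2 + 2 * j * κ) ≤ i + R := by omega
      have h2 : i ≤ 2 * (κ ^ 2 + 2 * j * κ) + R := by omega
      have h1' : 2 * ((κ : ℝ) ^ 2 + 2 * j * κ) ≤ i + R := by exact_mod_cast h1
      have h2' : (i : ℝ) ≤ 2 * ((κ : ℝ) ^ 2 + 2 * j * κ) + R := by exact_mod_cast h2
      rw [abs_le]
      constructor <;> linarith
  have hU_le : ∑ i ∈ U, g i ≤ (1 + (R : ℝ) / κ) * gammaTail σ κ := by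
    have ht : 0 ≤ ∑' i, g (i + κ ^ 2) := tsum_nonneg fun _ => hg0 _
    have hG : 0 ≤ ∑' i, g i := tsum_nonneg hg0
    have hRκ : 0 ≤ (R : ℝ) / κ := by positivity
    have hexp : (1 + (R : ℝ) / κ) * gammaTail σ κ = ∑' i, g (i + κ ^ 2) + (∑' i, g i) / κ +
        (R : ℝ) / κ * (∑' i, g (i + κ ^ 2)) + (R : ℝ) / κ * ((∑' i, g i) / κ) := by
      rw [gammaTail]
      ring
    have hGκ : 0 ≤ (∑' i, g i) / κ := by positivity
    rcases le_or_gt R (κ ^ 2) with hR | hR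
    · have hUsub : U ⊆ Finset.Ico (κ ^ 2) (κ ^ 2 + (U.sup id + 1)) := by
        intro i hi
        have hle : i ≤ U.sup id := Finset.le_sup (f := id) hi
        obtain ⟨j, -, hj⟩ := Finset.mem_biUnion.1 hi
        have hj' := (Finset.mem_Ico.1 hj).1
        have h0 : 0 ≤ 2 * j * κ := by positivity
        exact Finset.mem_Ico.2 ⟨by omega, by omega⟩
      have h1 : ∑ i ∈ U, g i ≤ ∑' i, g (i + κ ^ 2) := by
        refine (Finset.sum_le_sum_of_subset_of_nonneg hUsub fun i _ _ => hg0 i).trans ?_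
        rw [Finset.sum_Ico_eq_sum_range]
        simp_rw [add_comm (κ ^ 2)]
        exact ((summable_nat_add_iff (κ ^ 2)).2 hγ).sum_le_tsum _ fun i _ => hg0 _
      have := mul_nonneg hRκ ht
      have := mul_nonneg hRκ hGκ
      linarith
    -- For large `R` the windows may reach `0`, but then `R / κ²` exceeds `1`.
    · have h1 : ∑ i ∈ U, g i ≤ ∑' i, g i := hγ.sum_le_tsum _ fun i _ => hg0 i
      have h2 : ∑' i, g i ≤ (R : ℝ) / κ * ((∑' i, g i) / κ) := by
        have hR' : (κ : ℝ) ^ 2 ≤ R := by exact_mod_cast hR.le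
        rw [div_mul_div_comm, le_div_iff₀ (by positivity)]
        nlinarith
      have := mul_nonneg hRκ ht
      linarith
  calc ∑ j ∈ Finset.range κ, gammaWindow σ (2 * (κ ^ 2 + 2 * j * κ)) R
      = ∑ j ∈ Finset.range κ, ∑ i ∈ W j, g i := rfl
    _ = ∑ i ∈ U, ∑ j ∈ (Finset.range κ).filter fun j => i ∈ W j, g i := by
        refine Finset.sum_comm' fun j i => ?_
        simp only [hU, Finset.mem_biUnion, Finset.mem_filter]
        exact ⟨fun h => ⟨⟨h.1, h.2⟩, j, h.1, h.2⟩, fun h => h.1⟩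
    _ = ∑ i ∈ U, (((Finset.range κ).filter fun j => i ∈ W j).card : ℝ) * g i := by
        simp
    _ ≤ ∑ i ∈ U, (1 + (R : ℝ) / κ) * g i := by
        refine Finset.sum_le_sum fun i _ => ?_
        gcongr
        exact hcount i
    _ = (1 + (R : ℝ) / κ) * ∑ i ∈ U, g i := by rw [Finset.mul_sum]
    _ ≤ (1 + (R : ℝ) / κ) * ((1 + (R : ℝ) / κ) * gammaTail σ κ) := by gcongr
    _ = (1 + (R : ℝ) / κ) ^ 2 * gammaTail σ κ := by ring

end Counting

/-! ### An almost orthogonal Schur test -/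

section Schur

/-- The Schur test for a sum of vectors which are orthogonal unless their indices are related. -/
theorem norm_sum_smul_sq_le {E ι : Type*} [NormedAddCommGroup E] [InnerProductSpace ℂ E]
    (I : Finset ι) (c : ι → ℂ) (a : ι → ℝ) (d : ι → E) (r : ι → ι → Prop) [DecidableRel r]
    (hr : ∀ i k, r i k → r k i) (hc : ∀ i ∈ I, ‖c i‖ ≤ a i)
    (hd : ∀ i ∈ I, ∀ k ∈ I, ¬ r i k → inner ℂ (d i) (d k) = 0) :
    ‖∑ i ∈ I, c i • d i‖ ^ 2 ≤
      ∑ i ∈ I, a i * ‖d i‖ ^ 2 * ∑ k ∈ I.filter (r i), a k := by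
  have ha : ∀ i ∈ I, 0 ≤ a i := fun i hi => (norm_nonneg _).trans (hc i hi)
  have hterm : ∀ i ∈ I, ∀ k ∈ I, ‖inner ℂ (c i • d i) (c k • d k)‖ ≤
      (if r i k then a i * ‖d i‖ ^ 2 * a k else 0) / 2 +
        (if r k i then a k * ‖d k‖ ^ 2 * a i else 0) / 2 := by
    intro i hi k hk
    by_cases h : r i k
    · rw [if_pos h, if_pos (hr _ _ h)]
      have h1 : ‖inner ℂ (c i • d i) (c k • d k)‖ ≤ a i * a k * (‖d i‖ * ‖d k‖) := by
        refine (norm_inner_le_norm _ _).trans ?_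
        rw [norm_smul, norm_smul]
        have := hc i hi
        have := hc k hk
        have := ha i hi
        calc ‖c i‖ * ‖d i‖ * (‖c k‖ * ‖d k‖) = ‖c i‖ * ‖c k‖ * (‖d i‖ * ‖d k‖) := by ring
          _ ≤ a i * a k * (‖d i‖ * ‖d k‖) := by gcongr
      have h2 := mul_nonneg (mul_nonneg (ha i hi) (ha k hk)) (sq_nonneg (‖d i‖ - ‖d k‖))
      nlinarith
    · have h' : ¬ r k i := fun h' => h (hr _ _ h')
      rw [if_neg h, if_neg h', inner_smul_left, inner_smul_right, hd i hi k hk h]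
      simp
  have h0 : ‖∑ i ∈ I, c i • d i‖ ^ 2 =
      ‖inner ℂ (∑ i ∈ I, c i • d i) (∑ i ∈ I, c i • d i)‖ := by
    rw [inner_self_eq_norm_sq_to_K]
    simp
  have hswap : ∑ i ∈ I, ∑ k ∈ I, (if r k i then a k * ‖d k‖ ^ 2 * a i else 0) / 2 =
      ∑ i ∈ I, ∑ k ∈ I, (if r i k then a i * ‖d i‖ ^ 2 * a k else 0) / 2 :=
    Finset.sum_comm
  calc ‖∑ i ∈ I, c i • d i‖ ^ 2
      ≤ ∑ i ∈ I, ∑ k ∈ I, ‖inner ℂ (c i • d i) (c k • d k)‖ := by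
        rw [h0, sum_inner]
        refine (norm_sum_le _ _).trans (Finset.sum_le_sum fun i _ => ?_)
        rw [inner_sum]
        exact norm_sum_le _ _
    _ ≤ ∑ i ∈ I, ∑ k ∈ I, ((if r i k then a i * ‖d i‖ ^ 2 * a k else 0) / 2 +
        (if r k i then a k * ‖d k‖ ^ 2 * a i else 0) / 2) :=
        Finset.sum_le_sum fun i hi => Finset.sum_le_sum fun k hk => hterm i hi k hk
    _ = ∑ i ∈ I, ∑ k ∈ I, (if r i k then a i * ‖d i‖ ^ 2 * a k else 0) := by
        simp only [Finset.sum_add_distrib]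
        rw [hswap, ← Finset.sum_add_distrib]
        refine Finset.sum_congr rfl fun i _ => ?_
        rw [← Finset.sum_add_distrib]
        exact Finset.sum_congr rfl fun k _ => add_halves _
    _ = ∑ i ∈ I, a i * ‖d i‖ ^ 2 * ∑ k ∈ I.filter (r i), a k := by
        refine Finset.sum_congr rfl fun i _ => ?_
        rw [← Finset.sum_filter, Finset.mul_sum]

end Schur

/-! ### The combination of defects -/

section Packets

theorem sum_inv_freqWeight_sq_le {κ : ℕ} (hκ : 0 < κ) (S : Finset ℤ) :
    ∑ u ∈ S, 1 / (κ * freqWeight κ u ^ 2) ≤ 4 := by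
  obtain ⟨h1, h2⟩ := summable_inv_freqWeight_sq hκ
  refine (h1.sum_le_tsum S fun u _ => ?_).trans h2
  have := freqWeight_pos κ u
  positivity

variable (σ : Measure Circle) [IsProbabilityMeasure σ]

/-- The number of centers `κ² + 2kκ` within distance `|u| + |v|` of `κ² + 2jκ`. -/
theorem card_close_centers_le {κ : ℕ} (hκ : 0 < κ) (j : ℕ) (u v : ℤ) :
    (((Finset.range κ).filter fun k =>
      |((κ ^ 2 + 2 * j * κ : ℕ) : ℤ) - ((κ ^ 2 + 2 * k * κ : ℕ) : ℤ)| ≤ |u| + |v|).card : ℝ) ≤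
      freqWeight κ u * freqWeight κ v := by
  have hκ' : (0 : ℝ) < κ := by exact_mod_cast hκ
  refine (card_le_of_abs_sub_mul_le (c := 2 * κ) (R := |(u : ℝ)| + |(v : ℝ)|)
    (x := 2 * j * κ) (by positivity) (by positivity) ?_).trans ?_
  · intro k hk
    have h := (Finset.mem_filter.1 hk).2
    have h' : |(((κ ^ 2 + 2 * j * κ : ℕ) : ℤ) - ((κ ^ 2 + 2 * k * κ : ℕ) : ℤ) : ℝ)| ≤
        |(u : ℝ)| + |(v : ℝ)| := by exact_mod_cast h
    convert! h' using 2
    push_cast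
    ring
  · have h1 : 2 * (|(u : ℝ)| + |(v : ℝ)|) / (2 * κ) = |(u : ℝ)| / κ + |(v : ℝ)| / κ := by
      field_simp
    have h2 : 0 ≤ |(u : ℝ)| / κ * (|(v : ℝ)| / κ) := by positivity
    rw [h1, freqWeight, freqWeight]
    linarith

/-- The main term: the defects enter with small coefficients, each is orthogonal to all but a few
others, and their squared norms add up to a small quantity. -/
theorem norm_sum_defect_sq_le (hσ : σ.support.Infinite)
    (hγ : Summable fun n => ‖verblunsky σ n‖ ^ 2) {κ : ℕ} (hκ : 0 < κ) {A : ℝ} (hA : 0 ≤ A)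
    (c : ℕ → ℤ → ℂ) (hc : ∀ j < κ, ∀ u, ‖c j u‖ ≤ A / (κ * freqWeight κ u ^ 5)) :
    ‖∑ j ∈ Finset.range κ, ∑ u ∈ Finset.Icc (-(κ : ℤ) ^ 2) ((κ : ℤ) ^ 2),
      c j u • toL2 σ (defect σ (κ ^ 2 + 2 * j * κ) u)‖ ^ 2 ≤ 128 * A ^ 2 * gammaTail σ κ := by
  have hκ' : (0 : ℝ) < κ := by exact_mod_cast hκ
  have hε := gammaTail_nonneg σ κ
  set S := Finset.Icc (-(κ : ℤ) ^ 2) ((κ : ℤ) ^ 2) with hS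
  set n : ℕ → ℕ := fun j => κ ^ 2 + 2 * j * κ with hn
  have hSn : ∀ j, ∀ u ∈ S, |u| ≤ (n j : ℤ) := by
    intro j u hu
    have h1 : |u| ≤ (κ : ℤ) ^ 2 := abs_le.2 (Finset.mem_Icc.1 hu)
    have h2 : (n j : ℤ) = (κ : ℤ) ^ 2 + 2 * j * κ := by simp [hn]
    have h3 : (0 : ℤ) ≤ 2 * j * κ := by positivity
    omega
  let r : ℕ × ℤ → ℕ × ℤ → Prop := fun i k => |(n i.1 : ℤ) - n k.1| ≤ |i.2| + |k.2|
  let hdec : DecidableRel r := fun i k =>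
    inferInstanceAs (Decidable (|(n i.1 : ℤ) - n k.1| ≤ |i.2| + |k.2|))
  rw [← Finset.sum_product' (Finset.range κ) S
    (fun j u => c j u • toL2 σ (defect σ (n j) u))]
  refine (norm_sum_smul_sq_le (Finset.range κ ×ˢ S) (fun i => c i.1 i.2)
    (fun i => A / (κ * freqWeight κ i.2 ^ 5)) (fun i => toL2 σ (defect σ (n i.1) i.2)) r
    ?_ ?_ ?_).trans ?_
  · intro i k h
    change |(n k.1 : ℤ) - n i.1| ≤ |k.2| + |i.2|
    rw [abs_sub_comm, add_comm]
    exact h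
  · intro i hi
    exact hc _ (Finset.mem_range.1 (Finset.mem_product.1 hi).1) _
  · intro i hi k hk hik
    refine inner_defect_eq_zero σ hσ (hSn _ _ (Finset.mem_product.1 hi).2)
      (hSn _ _ (Finset.mem_product.1 hk).2) ?_
    rw [abs_sub_comm]
    exact not_le.1 hik
  -- Row sums of the Schur test: the number of close centers costs one power of each weight.
  have hrow : ∀ i : ℕ × ℤ, ∑ k ∈ (Finset.range κ ×ˢ S).filter (r i),
      A / (κ * freqWeight κ k.2 ^ 5) ≤ 4 * A * freqWeight κ i.2 := by
    intro i
    have hwi := freqWeight_pos κ i.2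
    rw [Finset.sum_filter, Finset.sum_product_right]
    have hv : ∀ v ∈ S, (∑ k ∈ Finset.range κ,
        if r i (k, v) then A / (κ * freqWeight κ v ^ 5) else 0) ≤
          A * freqWeight κ i.2 * (1 / (κ * freqWeight κ v ^ 2)) := by
      intro v _
      have hw := freqWeight_pos κ v
      have hw1 := one_le_freqWeight κ v
      rw [← Finset.sum_filter, Finset.sum_const, nsmul_eq_mul]
      calc _ ≤ (freqWeight κ i.2 * freqWeight κ v) * (A / (κ * freqWeight κ v ^ 5)) := by
            gcongr
            exact card_close_centers_le hκ i.1 i.2 v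
        _ = A * freqWeight κ i.2 * (1 / (κ * freqWeight κ v ^ 4)) := by
            field_simp
        _ ≤ A * freqWeight κ i.2 * (1 / (κ * freqWeight κ v ^ 2)) := by
            gcongr
            norm_num
    refine (Finset.sum_le_sum hv).trans ?_
    rw [← Finset.mul_sum]
    have := sum_inv_freqWeight_sq_le hκ S
    calc _ ≤ A * freqWeight κ i.2 * 4 := by gcongr
      _ = _ := by ring
  have hcol : ∀ u ∈ S, ∑ j ∈ Finset.range κ, ‖toL2 σ (defect σ (n j) u)‖ ^ 2 ≤
      8 * freqWeight κ u ^ 2 * gammaTail σ κ := by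
    intro u hu
    have h1 : ∑ j ∈ Finset.range κ, ‖toL2 σ (defect σ (n j) u)‖ ^ 2 ≤
        2 * ((1 + ((2 * u.natAbs : ℕ) : ℝ) / κ) ^ 2 * gammaTail σ κ) := by
      refine le_trans (Finset.sum_le_sum fun j _ => norm_defect_sq_le σ hσ (hSn j u hu)) ?_
      rw [← Finset.mul_sum]
      gcongr
      exact sum_gammaWindow_le σ hγ hκ _
    refine h1.trans ?_
    have h2 : 1 + ((2 * u.natAbs : ℕ) : ℝ) / κ ≤ 2 * freqWeight κ u := by
      rw [freqWeight]
      push_cast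
      rw [Nat.cast_natAbs, Int.cast_abs, mul_div_assoc]
      linarith
    have h3 : (1 + ((2 * u.natAbs : ℕ) : ℝ) / κ) ^ 2 ≤ (2 * freqWeight κ u) ^ 2 := by gcongr
    nlinarith
  calc _ ≤ ∑ i ∈ Finset.range κ ×ˢ S, A / (κ * freqWeight κ i.2 ^ 5) *
          ‖toL2 σ (defect σ (n i.1) i.2)‖ ^ 2 * (4 * A * freqWeight κ i.2) := by
        refine Finset.sum_le_sum fun i _ => ?_
        have hwi := freqWeight_pos κ i.2
        gcongr
        exact hrow i
    _ = ∑ u ∈ S, 4 * A ^ 2 / (κ * freqWeight κ u ^ 4) *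
          ∑ j ∈ Finset.range κ, ‖toL2 σ (defect σ (n j) u)‖ ^ 2 := by
        rw [Finset.sum_product_right]
        refine Finset.sum_congr rfl fun u _ => ?_
        rw [Finset.mul_sum]
        refine Finset.sum_congr rfl fun j _ => ?_
        have hw := freqWeight_pos κ u
        field_simp
    _ ≤ ∑ u ∈ S, 4 * A ^ 2 / (κ * freqWeight κ u ^ 4) *
          (8 * freqWeight κ u ^ 2 * gammaTail σ κ) := by
        refine Finset.sum_le_sum fun u hu => ?_
        have hw := freqWeight_pos κ u
        gcongr
        exact hcol u hu
    _ = 32 * A ^ 2 * gammaTail σ κ * ∑ u ∈ S, 1 / (κ * freqWeight κ u ^ 2) := by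
        rw [Finset.mul_sum]
        refine Finset.sum_congr rfl fun u _ => ?_
        have hw := freqWeight_pos κ u
        field_simp
        ring
    _ ≤ 32 * A ^ 2 * gammaTail σ κ * 4 := by
        gcongr
        exact sum_inv_freqWeight_sq_le hκ S
    _ = 128 * A ^ 2 * gammaTail σ κ := by ring

end Packets

/-! ### Truncation of the Fourier series of the bumps -/

section BumpMap

/-- The bump `ω_j` as a continuous function, defined by its Fourier series; this is `ω_j` for
`κ ≥ 3`, see `bumpMap_apply`. -/
noncomputable def bumpMap (h : ℝ → ℝ) (κ j : ℕ) : C(Circle, ℂ) :=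
  ∑' u : ℤ, bumpCoeff h κ j u • zpowMap u

variable {h : ℝ → ℝ}

theorem norm_zpowMap_le (u : ℤ) : ‖zpowMap u‖ ≤ 1 :=
  (ContinuousMap.norm_le _ zero_le_one).2 fun z => (norm_zpowMap_apply u z).le

theorem hasSum_bumpMap (h_smooth : ContDiff ℝ ∞ h)
    (h_supp : tsupport h ⊆ Set.Icc (-(2 * Real.pi)) (2 * Real.pi)) {κ : ℕ} (hκ : 3 ≤ κ) (j : ℕ) :
    HasSum (fun u : ℤ => bumpCoeff h κ j u • zpowMap u) (bumpMap h κ j) := by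
  refine Summable.hasSum (Summable.of_norm_bounded
    (summable_norm_bumpCoeff h h_smooth h_supp hκ j) fun u => ?_)
  rw [norm_smul]
  exact mul_le_of_le_one_right (norm_nonneg _) (norm_zpowMap_le u)

theorem bumpMap_apply (h_smooth : ContDiff ℝ ∞ h)
    (h_supp : tsupport h ⊆ Set.Icc (-(2 * Real.pi)) (2 * Real.pi)) {κ : ℕ} (hκ : 3 ≤ κ) (j : ℕ)
    (z : Circle) :
    bumpMap h κ j z = bump h κ j z := by
  have h1 := (hasSum_bumpMap h_smooth h_supp hκ j).mapL (ContinuousMap.evalCLM ℂ z)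
  refine h1.unique ?_
  simpa [zpowMap_apply] using! hasSum_bumpCoeff h h_smooth h_supp hκ j z

/-- Frequencies above `κ²` have weight at least `κ`. -/
theorem le_freqWeight_of_lt {κ : ℕ} (hκ : 0 < κ) {u : ℤ} (hu : (κ : ℤ) ^ 2 < |u|) :
    (κ : ℝ) ≤ freqWeight κ u := by
  have hκ' : (0 : ℝ) < κ := by exact_mod_cast hκ
  have hu' : (κ : ℝ) ^ 2 < |(u : ℝ)| := by exact_mod_cast hu
  have : (κ : ℝ) ≤ |(u : ℝ)| / κ := by
    rw [le_div_iff₀ hκ']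
    nlinarith
  rw [freqWeight]
  linarith

/-- The frequencies above `κ²` contribute only `O(κ⁻²)` to the bumps. -/
theorem norm_bumpMap_sub_sum_le (h_smooth : ContDiff ℝ ∞ h)
    (h_supp : tsupport h ⊆ Set.Icc (-(2 * Real.pi)) (2 * Real.pi)) {κ : ℕ} (hκ : 3 ≤ κ) (j : ℕ)
    {K : ℝ} (hK0 : 0 ≤ K)
    (hK : ∀ u, ‖bumpCoeff h κ j u‖ ≤ K / (κ * freqWeight κ u ^ 5)) :
    ‖bumpMap h κ j - ∑ u ∈ Finset.Icc (-(κ : ℤ) ^ 2) ((κ : ℤ) ^ 2),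
      bumpCoeff h κ j u • zpowMap u‖ ≤ 4 * K / κ ^ 2 := by
  have hκ0 : 0 < κ := by omega
  have hκ' : (0 : ℝ) < κ := by exact_mod_cast hκ0
  set S := Finset.Icc (-(κ : ℤ) ^ 2) ((κ : ℤ) ^ 2) with hS
  set F : ℤ → C(Circle, ℂ) := fun u => bumpCoeff h κ j u • zpowMap u with hF
  have h1 : HasSum (fun u => if u ∈ S then F u else 0) (∑ u ∈ S, F u) := by
    have := hasSum_sum_of_ne_finset_zero (L := SummationFilter.unconditional ℤ)
      (f := fun u => if u ∈ S then F u else 0) (s := S) fun u hu => if_neg hu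
    rwa [Finset.sum_congr rfl fun u hu => if_pos hu] at this
  obtain ⟨s1, s2⟩ := summable_inv_freqWeight_sq hκ0
  have h2 := ((hasSum_bumpMap h_smooth h_supp hκ j).sub h1).norm_le_of_bounded
    (s1.mul_left (K / κ ^ 2)).hasSum ?_
  · refine h2.trans ?_
    rw [tsum_mul_left]
    calc K / κ ^ 2 * ∑' u : ℤ, 1 / (κ * freqWeight κ u ^ 2) ≤ K / κ ^ 2 * 4 := by gcongr
      _ = 4 * K / κ ^ 2 := by ring
  · intro u
    have hw := freqWeight_pos κ u
    by_cases hu : u ∈ S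
    · rw [if_pos hu, sub_self, norm_zero]
      positivity
    · rw [if_neg hu, sub_zero, norm_smul]
      have hu' : (κ : ℤ) ^ 2 < |u| := by
        by_contra hle
        exact hu (Finset.mem_Icc.2 (abs_le.1 (not_lt.1 hle)))
      have hκw := le_freqWeight_of_lt hκ0 hu'
      have hw1 := one_le_freqWeight κ u
      have h3 : (κ : ℝ) ^ 2 * freqWeight κ u ^ 2 ≤ freqWeight κ u ^ 5 := by
        calc (κ : ℝ) ^ 2 * freqWeight κ u ^ 2 ≤ freqWeight κ u ^ 2 * freqWeight κ u ^ 2 := by gcongr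
          _ = freqWeight κ u ^ 4 := by ring
          _ ≤ freqWeight κ u ^ 5 := by
            gcongr
            norm_num
      calc ‖bumpCoeff h κ j u‖ * ‖zpowMap u‖ ≤ ‖bumpCoeff h κ j u‖ :=
            mul_le_of_le_one_right (norm_nonneg _) (norm_zpowMap_le u)
        _ ≤ K / (κ * freqWeight κ u ^ 5) := hK u
        _ ≤ K / (κ * (κ ^ 2 * freqWeight κ u ^ 2)) := by gcongr
        _ = K / κ ^ 2 * (1 / (κ * freqWeight κ u ^ 2)) := by field_simp

end BumpMap

/-! ### The difference of the two sums -/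

section Difference

variable (σ : Measure Circle) [IsProbabilityMeasure σ] {h : ℝ → ℝ}

/-- The difference of the packet sum and the localized sum as a continuous function, written as a
combination of defects minus the contribution of the frequencies above `κ²`. -/
noncomputable def differenceMap (h : ℝ → ℝ) (f : ℕ → ℕ → ℂ) (κ : ℕ) : C(Circle, ℂ) :=
  (∑ j ∈ Finset.range κ, ∑ u ∈ Finset.Icc (-(κ : ℤ) ^ 2) ((κ : ℤ) ^ 2),
      (f κ j * bumpCoeff h κ j u) • defect σ (κ ^ 2 + 2 * j * κ) u) -
    ∑ j ∈ Finset.range κ, f κ j • (sMap σ (κ ^ 2 + 2 * j * κ : ℕ) *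
      (bumpMap h κ j - ∑ u ∈ Finset.Icc (-(κ : ℤ) ^ 2) ((κ : ℤ) ^ 2),
        bumpCoeff h κ j u • zpowMap u))

theorem differenceMap_apply (h_smooth : ContDiff ℝ ∞ h)
    (h_supp : tsupport h ⊆ Set.Icc (-(2 * Real.pi)) (2 * Real.pi)) (f : ℕ → ℕ → ℂ)
    {κ : ℕ} (hκ : 3 ≤ κ) (z : Circle) :
    differenceMap σ h f κ z = packetSum σ h f κ z - localizedSum σ h f κ z := by
  simp only [differenceMap, packetSum, localizedSum, ContinuousMap.sub_apply,
    ContinuousMap.sum_apply, ContinuousMap.smul_apply, ContinuousMap.mul_apply, smul_eq_mul,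
    ← Finset.sum_sub_distrib, bumpMap_apply h_smooth h_supp hκ]
  refine Finset.sum_congr rfl fun j _ => ?_
  have e : ∀ u : ℤ, (f κ j * bumpCoeff h κ j u) * defect σ (κ ^ 2 + 2 * j * κ) u z =
      f κ j * s σ ((κ : ℤ) ^ 2 + 2 * j * κ + u).toNat z * bumpCoeff h κ j u -
        f κ j * (s σ (κ ^ 2 + 2 * j * κ) z * (bumpCoeff h κ j u * zpowMap u z)) := by
    intro u
    rw [defect, ContinuousMap.sub_apply, ContinuousMap.mul_apply, sMap_apply, sMap_apply,
      Int.toNat_natCast]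
    push_cast
    ring
  simp only [e, Finset.sum_sub_distrib, ← Finset.mul_sum, sMap_apply, Int.toNat_natCast]
  ring

theorem tendsto_norm_differenceMap (h_smooth : ContDiff ℝ ∞ h)
    (h_supp : tsupport h ⊆ Set.Icc (-(2 * Real.pi)) (2 * Real.pi)) (hσ : σ.support.Infinite)
    (hγ : Summable fun n => ‖verblunsky σ n‖ ^ 2)
    (f : ℕ → ℕ → ℂ) {M : ℝ} (hM : 0 ≤ M) (hf : ∀ κ j : ℕ, j < κ → ‖f κ j‖ ≤ M) :
    Tendsto (fun κ => ‖toL2 σ (differenceMap σ h f κ)‖) atTop (𝓝 0) := by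
  obtain ⟨K, hK0, hK⟩ := exists_norm_bumpCoeff_le h h_smooth h_supp
  have hlim : Tendsto (fun κ : ℕ => √(128 * (M * K) ^ 2 * gammaTail σ κ) + 4 * M * K / (κ : ℝ))
      atTop (𝓝 0) := by
    have h1 := (((tendsto_gammaTail σ).const_mul (128 * (M * K) ^ 2)).sqrt).add
      (tendsto_const_nhds (x := 4 * M * K) |>.div_atTop tendsto_natCast_atTop_atTop)
    simpa using! h1
  refine squeeze_zero' (Eventually.of_forall fun _ => norm_nonneg _) ?_ hlim
  filter_upwards [eventually_ge_atTop 3] with κ hκ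
  have hκ0 : 0 < κ := by omega
  have hκ' : (0 : ℝ) < κ := by exact_mod_cast hκ0
  rw [differenceMap, map_sub]
  refine (norm_sub_le _ _).trans (add_le_add ?_ ?_)
  · refine Real.le_sqrt_of_sq_le ?_
    simp only [map_sum, map_smul]
    refine norm_sum_defect_sq_le σ hσ hγ hκ0 (by positivity) _ fun j hj u => ?_
    have hw := freqWeight_pos κ u
    rw [norm_mul, mul_div_assoc]
    gcongr
    · exact hf κ j hj
    · exact hK κ hκ j u
  · simp only [map_sum, map_smul]
    have hterm : ∀ j ∈ Finset.range κ, ‖f κ j • toL2 σ (sMap σ (κ ^ 2 + 2 * j * κ : ℕ) *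
        (bumpMap h κ j - ∑ u ∈ Finset.Icc (-(κ : ℤ) ^ 2) ((κ : ℤ) ^ 2),
          bumpCoeff h κ j u • zpowMap u))‖ ≤ M * (4 * K / κ ^ 2) := by
      intro j hj
      rw [norm_smul]
      gcongr
      · exact hf κ j (Finset.mem_range.1 hj)
      · have hb := norm_bumpMap_sub_sum_le h_smooth h_supp hκ j hK0 (hK κ hκ j)
        refine (norm_toL2_mul_le σ _ _ (c := 4 * K / κ ^ 2) (by positivity)
          fun z => (ContinuousMap.norm_coe_le_norm _ z).trans hb).trans ?_
        rw [norm_sMap σ hσ, mul_one]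
    refine (norm_sum_le _ _).trans ((Finset.sum_le_sum hterm).trans ?_)
    rw [Finset.sum_const, Finset.card_range, nsmul_eq_mul]
    apply le_of_eq
    field_simp

end Difference

/-! ### Moments of `|φ_N|² dσ` -/

section Moments

variable (σ : Measure Circle) [IsProbabilityMeasure σ] {h : ℝ → ℝ}

/-- The `u`-th moment of the probability measure `|φ_N|² dσ`. -/
noncomputable def moment (N : ℕ) (u : ℤ) : ℂ :=
  inner ℂ (toL2 σ (phiMap σ N)) (toL2 σ (phiMap σ N * zpowMap u))

theorem norm_moment_le_one (hσ : σ.support.Infinite) (N : ℕ) (u : ℤ) : ‖moment σ N u‖ ≤ 1 := by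
  refine (norm_inner_le_norm _ _).trans ?_
  rw [mul_comm (phiMap σ N), norm_zpowMap_mul, norm_phiMap σ hσ, one_mul]

theorem moment_zero (hσ : σ.support.Infinite) (N : ℕ) : moment σ N 0 = 1 := by
  rw [moment, zpowMap_zero, mul_one, inner_self_eq_norm_sq_to_K, norm_phiMap σ hσ]
  simp

theorem norm_moment_le (hσ : σ.support.Infinite) {N : ℕ} {u : ℤ} (hu : u ≠ 0)
    (huN : u.natAbs ≤ N) : ‖moment σ N u‖ ≤ 2 * gammaWindow σ N u.natAbs := by
  have h1 := norm_inner_zpowMap_phiMap_le σ hσ (Int.natAbs_pos.2 hu) huN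
  rw [moment, mul_comm (phiMap σ N)]
  rcases Int.natAbs_eq u with h | h
  · rw [← h] at h1
    rwa [norm_inner_symm]
  · have e : (u.natAbs : ℤ) = -u := by omega
    rwa [e, inner_zpowMap_mul_left, neg_neg] at h1

/-- Summed over the centers, a nontrivial moment is small up to powers of the frequency weight. -/
theorem sum_norm_moment_le (hσ : σ.support.Infinite)
    (hγ : Summable fun n => ‖verblunsky σ n‖ ^ 2) {κ : ℕ} (hκ : 0 < κ) {u : ℤ} (hu : u ≠ 0) :
    ∑ j ∈ Finset.range κ, ‖moment σ (2 * (κ ^ 2 + 2 * j * κ)) u‖ ≤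
      freqWeight κ u ^ 2 * (2 * gammaTail σ κ + 1 / κ) := by
  have hκ' : (0 : ℝ) < κ := by exact_mod_cast hκ
  have hε := gammaTail_nonneg σ κ
  have hw := freqWeight_pos κ u
  rw [mul_add]
  rcases le_or_gt |u| ((κ : ℤ) ^ 2) with hle | hlt
  · have hle' : u.natAbs ≤ κ ^ 2 := by
      rw [Int.abs_eq_natAbs] at hle
      exact_mod_cast hle
    have h1 : ∑ j ∈ Finset.range κ, ‖moment σ (2 * (κ ^ 2 + 2 * j * κ)) u‖ ≤
        2 * ((1 + (u.natAbs : ℝ) / κ) ^ 2 * gammaTail σ κ) := by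
      refine (Finset.sum_le_sum fun j _ => norm_moment_le σ hσ hu ?_).trans ?_
      · have : 0 ≤ 2 * j * κ := by positivity
        omega
      · rw [← Finset.mul_sum]
        gcongr
        exact sum_gammaWindow_le σ hγ hκ _
    have e : 1 + (u.natAbs : ℝ) / κ = freqWeight κ u := by
      rw [freqWeight, Nat.cast_natAbs, Int.cast_abs]
    rw [e] at h1
    have : 0 ≤ freqWeight κ u ^ 2 * (1 / κ) := by positivity
    linarith
  -- For high frequencies the trivial bound `1` for each moment suffices.
  · have hκw := le_freqWeight_of_lt hκ hlt
    have h1 : ∑ j ∈ Finset.range κ, ‖moment σ (2 * (κ ^ 2 + 2 * j * κ)) u‖ ≤ κ := by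
      refine (Finset.sum_le_sum fun j _ => norm_moment_le_one σ hσ _ u).trans ?_
      simp
    have h2 : (κ : ℝ) ≤ freqWeight κ u ^ 2 * (1 / κ) := by
      rw [mul_one_div, le_div_iff₀ hκ', sq]
      gcongr
    have : 0 ≤ freqWeight κ u ^ 2 * (2 * gammaTail σ κ) := by positivity
    linarith

instance : IsFiniteMeasure arcMeasure := by
  unfold arcMeasure
  exact Measure.smul_finite _ ENNReal.ofReal_ne_top

theorem contDiff_sq_and_tsupport (h_smooth : ContDiff ℝ ∞ h)
    (h_supp : tsupport h ⊆ Set.Icc (-(2 * Real.pi)) (2 * Real.pi)) :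
    ContDiff ℝ ∞ (fun x => h x ^ 2) ∧
      tsupport (fun x => h x ^ 2) ⊆ Set.Icc (-(2 * Real.pi)) (2 * Real.pi) := by
  refine ⟨h_smooth.pow 2, (closure_mono fun x hx => ?_).trans h_supp⟩
  intro h0
  exact hx (by simp [h0])

/-- Expansion of the localized norm into moments. The squares `ω_j²` are the bumps of the profile
`h²`. -/
theorem hasSum_moment (h_smooth : ContDiff ℝ ∞ h)
    (h_supp : tsupport h ⊆ Set.Icc (-(2 * Real.pi)) (2 * Real.pi)) (hσ : σ.support.Infinite)
    {κ : ℕ} (hκ : 3 ≤ κ) (j N : ℕ) :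
    HasSum (fun u : ℤ => if u = 0 then 0 else
        bumpCoeff (fun x => h x ^ 2) κ j u * moment σ N u)
      ((l2Norm σ (fun z => phiStar σ N z * (bump h κ j z : ℂ)) ^ 2 -
        ∫ z, |bump h κ j z| ^ 2 ∂arcMeasure : ℝ) : ℂ) := by
  obtain ⟨h2_smooth, h2_supp⟩ := contDiff_sq_and_tsupport h_smooth h_supp
  set β := bumpCoeff (fun x => h x ^ 2) κ j with hβ
  set W := bumpMap (fun x => h x ^ 2) κ j with hW
  let T : C(Circle, ℂ) →L[ℂ] ℂ := (innerSL ℂ (toL2 σ (phiMap σ N))).comp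
    ((toL2 σ).comp (ContinuousLinearMap.mul ℂ C(Circle, ℂ) (phiMap σ N)))
  have hT := (hasSum_bumpMap h2_smooth h2_supp hκ j).mapL T
  have hT' : HasSum (fun u : ℤ => β u * moment σ N u) (T W) := by
    convert! hT using 1
    ext u
    rw [map_smul, smul_eq_mul]
    rfl
  have h0 : β 0 * moment σ N 0 = ((∫ z, |bump h κ j z| ^ 2 ∂arcMeasure : ℝ) : ℂ) := by
    rw [moment_zero σ hσ, mul_one, hβ, bumpCoeff, ← integral_complex_ofReal]
    refine integral_congr_ae (Eventually.of_forall fun z => ?_)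
    simp [bump]
  have hTW : T W = ((l2Norm σ (fun z => phiStar σ N z * (bump h κ j z : ℂ)) ^ 2 : ℝ) : ℂ) := by
    have e : (fun z => phiStar σ N z * (bump h κ j z : ℂ)) = ⇑(zpowMap N *
        (star (phiMap σ N) * bumpMap h κ j)) := by
      ext z
      simp [phiStar, zpowMap_apply, phiMap_apply, bumpMap_apply h_smooth h_supp hκ, mul_assoc]
    rw [e, l2Norm_eq_norm_toL2, norm_zpowMap_mul, norm_toL2_sq, ← integral_complex_ofReal]
    change inner ℂ (toL2 σ (phiMap σ N)) (toL2 σ (phiMap σ N * W)) = _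
    rw [inner_toL2]
    refine integral_congr_ae (Eventually.of_forall fun z => ?_)
    simp only [ContinuousMap.mul_apply, ContinuousMap.star_apply, norm_mul, norm_star, hW,
      bumpMap_apply h_smooth h_supp hκ, bumpMap_apply h2_smooth h2_supp hκ]
    rw [mul_right_comm, Complex.mul_conj, Complex.normSq_eq_norm_sq, Complex.norm_real, mul_pow,
      Real.norm_eq_abs, sq_abs]
    simp [bump]
  rw [Complex.ofReal_sub, ← hTW, ← h0]
  have := hT'.sub (hasSum_ite_eq (0 : ℤ) (β 0 * moment σ N 0))
  convert! this using 1
  ext u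
  split_ifs with hu
  · rw [hu, sub_self]
  · rw [sub_zero]

theorem tendsto_localized_norms (h_smooth : ContDiff ℝ ∞ h)
    (h_supp : tsupport h ⊆ Set.Icc (-(2 * Real.pi)) (2 * Real.pi)) (hσ : σ.support.Infinite)
    (hγ : Summable fun n => ‖verblunsky σ n‖ ^ 2)
    (f : ℕ → ℕ → ℂ) {M : ℝ} (hf : ∀ κ j : ℕ, j < κ → ‖f κ j‖ ≤ M) :
    Tendsto (fun κ : ℕ =>
      (∑ j ∈ Finset.range κ, ‖f κ j‖ ^ 2 *
        l2Norm σ (fun z => phiStar σ (2 * (κ ^ 2 + 2 * j * κ)) z * (bump h κ j z : ℂ)) ^ 2) -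
      ∫ z : Circle, ∑ j ∈ Finset.range κ, ‖f κ j‖ ^ 2 * |bump h κ j z| ^ 2 ∂arcMeasure)
      atTop (𝓝 0) := by
  obtain ⟨h2_smooth, h2_supp⟩ := contDiff_sq_and_tsupport h_smooth h_supp
  obtain ⟨K, hK0, hK⟩ := exists_norm_bumpCoeff_le _ h2_smooth h2_supp
  have hlim : Tendsto (fun κ : ℕ => M ^ 2 * K * (2 * gammaTail σ κ + 1 / (κ : ℝ)) * 4)
      atTop (𝓝 0) := by
    have h1 := (((((tendsto_gammaTail σ).const_mul 2).add
      (tendsto_const_nhds (x := (1 : ℝ)) |>.div_atTop tendsto_natCast_atTop_atTop)).const_mul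
        (M ^ 2 * K)).mul_const 4)
    simpa using! h1
  refine squeeze_zero_norm' ?_ hlim
  filter_upwards [eventually_ge_atTop 3] with κ hκ
  have hκ0 : 0 < κ := by omega
  have hκ' : (0 : ℝ) < κ := by exact_mod_cast hκ0
  have hε := gammaTail_nonneg σ κ
  have hint : ∀ j, Integrable (fun z => ‖f κ j‖ ^ 2 * |bump h κ j z| ^ 2) arcMeasure := by
    intro j
    refine Integrable.const_mul ?_ _
    have e : (fun z => |bump h κ j z| ^ 2) = fun z => ‖bumpMap h κ j z‖ ^ 2 := by
      ext z
      rw [bumpMap_apply h_smooth h_supp hκ, Complex.norm_real, Real.norm_eq_abs]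
    rw [e]
    exact ((map_continuous (bumpMap h κ j)).norm.pow 2).integrable_of_hasCompactSupport
      (HasCompactSupport.of_compactSpace _)
  rw [integral_finsetSum _ fun j _ => hint j, ← Finset.sum_sub_distrib]
  simp_rw [integral_const_mul, ← mul_sub]
  have hS := hasSum_sum (s := Finset.range κ) fun j _ =>
    (hasSum_moment σ h_smooth h_supp hσ hκ j (2 * (κ ^ 2 + 2 * j * κ))).mul_left
      ((‖f κ j‖ ^ 2 : ℝ) : ℂ)
  obtain ⟨s1, s2⟩ := summable_inv_freqWeight_sq hκ0
  have hb := hS.norm_le_of_bounded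
    (s1.mul_left (M ^ 2 * K * (2 * gammaTail σ κ + 1 / κ))).hasSum ?_
  · rw [tsum_mul_left] at hb
    simp_rw [← Complex.ofReal_mul] at hb
    rw [← Complex.ofReal_sum, Complex.norm_real] at hb
    refine hb.trans ?_
    gcongr
  · intro u
    have hw := freqWeight_pos κ u
    have hw1 := one_le_freqWeight κ u
    by_cases hu : u = 0
    · simp only [hu, if_true, mul_zero, Finset.sum_const_zero, norm_zero]
      have := freqWeight_pos κ 0
      positivity
    · simp only [if_neg hu]
      have hterm : ∀ j ∈ Finset.range κ, ‖((‖f κ j‖ ^ 2 : ℝ) : ℂ) *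
          (bumpCoeff (fun x => h x ^ 2) κ j u * moment σ (2 * (κ ^ 2 + 2 * j * κ)) u)‖ ≤
          M ^ 2 * (K / (κ * freqWeight κ u ^ 5)) * ‖moment σ (2 * (κ ^ 2 + 2 * j * κ)) u‖ := by
        intro j hj
        have := hf κ j (Finset.mem_range.1 hj)
        rw [norm_mul, norm_mul, Complex.norm_real, norm_pow, norm_norm, ← mul_assoc]
        gcongr
        exact hK κ hκ j u
      refine (norm_sum_le _ _).trans ((Finset.sum_le_sum hterm).trans ?_)
      rw [← Finset.mul_sum]
      calc _ ≤ M ^ 2 * (K / (κ * freqWeight κ u ^ 5)) *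
            (freqWeight κ u ^ 2 * (2 * gammaTail σ κ + 1 / κ)) := by
            gcongr
            exact sum_norm_moment_le σ hσ hγ hκ0 hu
        _ = M ^ 2 * K * (2 * gammaTail σ κ + 1 / κ) * (1 / (κ * freqWeight κ u ^ 3)) := by
            field_simp
        _ ≤ M ^ 2 * K * (2 * gammaTail σ κ + 1 / κ) * (1 / (κ * freqWeight κ u ^ 2)) := by
            gcongr
            norm_num

end Moments

end OPUC

theorem corollary2p4
    (σ : Measure Circle) [IsProbabilityMeasure σ] (hσ : σ.support.Infinite)
    (hγ : Summable fun n => ‖OPUC.verblunsky σ n‖ ^ 2)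
    (hγ' : √(∑' n, ‖OPUC.verblunsky σ n‖ ^ 2) ≤ 1 / 2)
    (h : ℝ → ℝ) (h_smooth : ContDiff ℝ ∞ h) (h_nonneg : ∀ x, 0 ≤ h x)
    (h_supp : tsupport h ⊆ Set.Icc (-(2 * Real.pi)) (2 * Real.pi))
    (h_part : ∀ᶠ κ : ℕ in atTop, ∀ z : Circle,
      ∑ j ∈ Finset.range κ, OPUC.bump h κ j z = 1)
    (f : ℕ → ℕ → ℂ) (hf : ∃ C : ℝ, ∀ κ j : ℕ, j < κ → ‖f κ j‖ ≤ C) :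
    (∀ᶠ κ : ℕ in atTop, ∀ j < κ, ∀ z : Circle,
      HasSum (fun u : ℤ => OPUC.bumpCoeff h κ j u * (z : ℂ) ^ u) (OPUC.bump h κ j z : ℂ)) ∧
    Tendsto (fun κ : ℕ =>
      eLpNorm (fun z => OPUC.packetSum σ h f κ z - OPUC.localizedSum σ h f κ z) 2 σ)
      atTop (𝓝 0) ∧
    Tendsto (fun κ : ℕ =>
      (∑ j ∈ Finset.range κ, ‖f κ j‖ ^ 2 *
        OPUC.l2Norm σ (fun z =>
          OPUC.phiStar σ (2 * (κ ^ 2 + 2 * j * κ)) z * (OPUC.bump h κ j z : ℂ)) ^ 2) -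
      ∫ z : Circle, ∑ j ∈ Finset.range κ, ‖f κ j‖ ^ 2 * |OPUC.bump h κ j z| ^ 2
        ∂OPUC.arcMeasure)
      atTop (𝓝 0) := by
  obtain ⟨M, hM⟩ := hf
  have hM0 : 0 ≤ M := (norm_nonneg _).trans (hM 1 0 one_pos)
  refine ⟨?_, ?_, OPUC.tendsto_localized_norms σ h_smooth h_supp hσ hγ f hM⟩
  · filter_upwards [eventually_ge_atTop 3] with κ hκ j _ z
    exact OPUC.hasSum_bumpCoeff h h_smooth h_supp hκ j z
  · have hlim := ENNReal.tendsto_ofReal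
      (OPUC.tendsto_norm_differenceMap σ h_smooth h_supp hσ hγ f hM0 hM)
    rw [ENNReal.ofReal_zero] at hlim
    refine hlim.congr' ?_
    filter_upwards [eventually_ge_atTop 3] with κ hκ
    rw [← OPUC.eLpNorm_eq_norm_toL2]
    congr 1
    ext z
    exact OPUC.differenceMap_apply σ h_smooth h_supp f hκ z
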